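/- Consider $q$ agents and $d$ objects, and a bipartite stochastic blockmodel with $K$ agent types and $L$ object types: the agent types $s(i)$ and object types $t(j)$ are mutually independent with $\mathbb P(s(i)=k)=w_k$ and $\mathbb P(t(j)=l)=v_l$, where $w,v$ are probability vectors; given all the types, the edges between agents and objects are mutually independent and agent $i$ is joined to object $j$ ($i\sim j$) with probability $p_{s(i)t(j)}$, where $p_{kl}\in[0,1]$. Let $Q\subseteq\{1,\dots,q\}$ be nonempty, let $\lambda>0$ and, for each object $j$, $\mu_j>0$ (mean claim size) and $c_j^{\rm prem}>0$ (premium rate). Write $Q\sim j$ if $i\sim j$ for some $i\in Q$, $I_j=\mathbb 1\{Q\sim j\}$, $\xi_j=c_j^{\rm prem}/(\lambda\mu_j)$, and $$P^Q=\lambda\,\frac{\sum_{j=1}^d I_j}{\sum_{j=1}^d I_j\,c_j^{\rm prem}/\mu_j},\qquad \tfrac00:=0.$$ Let $C^Q=(s(i))_{i\in Q},(t(j))_{1\le j\le d}$ be the type configuration of $Q$ and all objects, and $C^Q_j=(s(i))_{i\in Q},t(j)$; a realisation $c$ of $C^Q$ induces a realisation $c_j$ of $C^Q_j$. Put $p(c_j)=\mathbb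 P(Q\sim j\mid C^Q_j=c_j)$ and $\sigma^2(c)=\sum_{j=1}^d(\xi_j-1)^2p(c_j)(1-p(c_j))$, and assume $\sigma^2(c)>0$ for every $c$ with $\mathbb P(C^Q=c)>0$. Let $N$ be a random variable whose law is the mixture, with weights $\mathbb P(C^Q=c)$, of the normal distributions with mean $\sum_{j=1}^d(\xi_j-1)p(c_j)$ and variance $\sigma^2(c)$. Then $$\bigl|\mathbb P(P^Q<1)-\mathbb P(N>0)\bigr|\le 9.4\sum_c\mathbb P(C^Q=c)\sum_{j=1}^d\mathbb E\bigl[|Z_j(c)|^3\,\big|\,C^Q=c\bigr],\qquad Z_j(c)=\frac{(\xi_j-1)(I_j-p(c_j))}{\sigma(c)},$$ where the sum is over all $c$ with $\mathbb P(C^Q=c)>0$. -/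

import Mathlib

open MeasureTheory ProbabilityTheory

/-- A bipartite stochastic blockmodel on a probability space `(Ω, P)`, with `q` agents of `K`
types and `d` objects of `L` types: the random types, the random edges and the parameters,
together with the defining properties of their joint law. -/
structure BipartiteSBM {Ω : Type*} [MeasurableSpace Ω] (P : Measure Ω) (q d K L : ℕ) where
  /-- probabilities of the types of an agent -/
  w : Fin K → ℝ
  /-- probabilities of the types of an object -/
  v : Fin L → ℝ
  /-- edge probability between an agent of type `k` and an object of type `l` -/
  p : Fin K → Fin L → ℝ
  w_mem : w ∈ stdSimplex ℝ (Fin K)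
  v_mem : v ∈ stdSimplex ℝ (Fin L)
  p_mem : ∀ k l, p k l ∈ Set.Icc (0 : ℝ) 1
  /-- the random type of an agent -/
  s : Fin q → Ω → Fin K
  /-- the random type of an object -/
  t : Fin d → Ω → Fin L
  /-- `edge i j` is the event that there is an edge between agent `i` and object `j` -/
  edge : Fin q → Fin d → Set Ω
  measurable_s : ∀ i, Measurable (s i)
  measurable_t : ∀ j, Measurable (t j)
  measurableSet_edge : ∀ i j, MeasurableSet (edge i j)
  law_s : ∀ i k, P.real {ω | s i ω = k} = w k
  law_t : ∀ j l, P.real {ω | t j ω = l} = v l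
  /-- all the types (of agents and of objects together) are mutually independent -/
  indep_s : iIndepFun s P
  indep_t : iIndepFun t P
  indep_types : IndepFun (fun ω i => s i ω) (fun ω j => t j ω) P
  /-- given the full type configuration, an agent of type `k` and an object of type `l` are
  joined with probability `p k l` -/
  cond_edge : ∀ (a : Fin q → Fin K) (b : Fin d → Fin L),
    P {ω | (∀ i, s i ω = a i) ∧ ∀ j, t j ω = b j} ≠ 0 → ∀ i j,
      (P[|{ω | (∀ i, s i ω = a i) ∧ ∀ j, t j ω = b j}]).real (edge i j) = p (a i) (b j)
  /-- given the full type configuration, the edges are mutually independent -/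
  cond_indep : ∀ (a : Fin q → Fin K) (b : Fin d → Fin L),
    P {ω | (∀ i, s i ω = a i) ∧ ∀ j, t j ω = b j} ≠ 0 →
      iIndepSet (fun e : Fin q × Fin d => edge e.1 e.2)
        (P[|{ω | (∀ i, s i ω = a i) ∧ ∀ j, t j ω = b j}])

/-- A value `c` of the type configuration `C^Q`: a type for each agent of `Q` and a type for each
object. -/
abbrev QConfig {q : ℕ} (Q : Finset (Fin q)) (d K L : ℕ) : Type :=
  (Q → Fin K) × (Fin d → Fin L)

/-- `ξ_j = 1 / ρ_j`, where `ρ_j = lam * μ_j / c_j`; here `prem j` is the premium rate `c_j`. -/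
noncomputable def xi {d : ℕ} (lam : ℝ) (μ prem : Fin d → ℝ) (j : Fin d) : ℝ :=
  1 / (lam * μ j / prem j)

namespace BipartiteSBM

variable {Ω : Type*} [MeasurableSpace Ω] {P : Measure Ω} {q d K L : ℕ}

/-- The event `Q ∼ j`: some agent of `Q` is joined to the object `j`. -/
def connected (M : BipartiteSBM P q d K L) (Q : Finset (Fin q)) (j : Fin d) : Set Ω :=
  ⋃ i ∈ Q, M.edge i j

/-- The indicator `I_j` of `Q ∼ j`. -/
noncomputable def I (M : BipartiteSBM P q d K L) (Q : Finset (Fin q)) (j : Fin d) : Ω → ℝ :=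
  (M.connected Q j).indicator 1

/-- The network Pollaczek–Khintchine random variable `P^Q`. Division in `ℝ` satisfies the
required convention `0 / 0 = 0`. -/
noncomputable def PQ (M : BipartiteSBM P q d K L) (Q : Finset (Fin q)) (lam : ℝ)
    (μ prem : Fin d → ℝ) (ω : Ω) : ℝ :=
  lam * ((∑ j, M.I Q j ω) / ∑ j, M.I Q j ω * (prem j / μ j))

/-- The event `C^Q = c`. -/
def configEvent (M : BipartiteSBM P q d K L) {Q : Finset (Fin q)} (c : QConfig Q d K L) : Set Ω :=
  {ω | (∀ i : Q, M.s i ω = c.1 i) ∧ ∀ j, M.t j ω = c.2 j}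

/-- The event `C^Q_j = c_j`, where `c_j` is the restriction of `c` to the agents of `Q` and the
object `j`. -/
def configEventAt (M : BipartiteSBM P q d K L) {Q : Finset (Fin q)} (c : QConfig Q d K L)
    (j : Fin d) : Set Ω :=
  {ω | (∀ i : Q, M.s i ω = c.1 i) ∧ M.t j ω = c.2 j}

/-- `p(c_j) = P(Q ∼ j | C^Q_j = c_j)`. -/
noncomputable def pc (M : BipartiteSBM P q d K L) {Q : Finset (Fin q)} (c : QConfig Q d K L)
    (j : Fin d) : ℝ :=
  (P[|M.configEventAt c j]).real (M.connected Q j)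

/-- The mean `∑ j, (ξ_j - 1) p(c_j)` of `N(c)`. -/
noncomputable def mean (M : BipartiteSBM P q d K L) {Q : Finset (Fin q)} (lam : ℝ)
    (μ prem : Fin d → ℝ) (c : QConfig Q d K L) : ℝ :=
  ∑ j, (xi lam μ prem j - 1) * M.pc c j

/-- `σ²(c) = ∑ j, (ξ_j - 1)² p(c_j) (1 - p(c_j))`. -/
noncomputable def sigmaSq (M : BipartiteSBM P q d K L) {Q : Finset (Fin q)} (lam : ℝ)
    (μ prem : Fin d → ℝ) (c : QConfig Q d K L) : ℝ :=
  ∑ j, (xi lam μ prem j - 1) ^ 2 * M.pc c j * (1 - M.pc c j)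

/-- `Z_j(c) = (ξ_j - 1) (I_j - p(c_j)) / σ(c)`. -/
noncomputable def Z (M : BipartiteSBM P q d K L) {Q : Finset (Fin q)} (lam : ℝ)
    (μ prem : Fin d → ℝ) (c : QConfig Q d K L) (j : Fin d) (ω : Ω) : ℝ :=
  1 / √(M.sigmaSq lam μ prem c) * (xi lam μ prem j - 1) * (M.I Q j ω - M.pc c j)

/-- The law of `N`: the mixture of the normal laws of the `N(c)`, with weights `P(C^Q = c)`. -/
noncomputable def mixtureLaw (M : BipartiteSBM P q d K L) (Q : Finset (Fin q)) (lam : ℝ)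
    (μ prem : Fin d → ℝ) : Measure ℝ :=
  ∑ c : QConfig Q d K L,
    P (M.configEvent c) • gaussianReal (M.mean lam μ prem c) (M.sigmaSq lam μ prem c).toNNReal

end BipartiteSBM

/-! Put S = ∑ (ξ_j - 1) I_j. Clearing denominators, P^Q < 1 means S > 0, except when every I_j
vanishes: then P^Q = 0 < 1 although S = 0. Hence {S > 0} ⊆ {P^Q < 1} ⊆ {S ≥ 0}. Given C^Q = c, the
I_j are independent with means p(c_j), because the edges at distinct objects are conditionally
independent and the types of agents outside Q play no role. So S standardised is ∑ Z_j(c), a sum of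
independent bounded centred variables with total variance 1. A Berry–Esseen bound with constant 9.4,
applied to both the strict and the non-strict event, gives the estimate for each c
(`abs_cond_real_PQ_lt_one_sub_le`); averaging over c gives the theorem.

The Berry–Esseen bound (`abs_measure_sum_le_sub_normalTail_le`) is proved by Stein's method. Let W =
∑ X_i, γ = ∑ E|X_i|³, and let f solve f'(w) - w f(w) = 1{w ≤ z} - P(Z ≤ z). Then P(W ≤ z) - P(Z ≤ z)
is E f'(W) - E W f(W), with f' read through `steinKernel` so that the kink at z is harmless. Each E
X_i f(W) is compared with E X_i² · E f'(W) by leaving X_i out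
(`abs_integral_mul_steinSolution_sub_le`). This needs E f'(V + t), with V = W - X_i, to vary little
in t. The smooth part of f' is controlled by 0 ≤ f ≤ 1.26 and |f'| ≤ 1; its jump is controlled by a
bound on P(a ≤ V ≤ b) that is linear in b - a up to a multiple of γ
(`measure_sum_erase_mem_Icc_le`). -/

/-! ### Normal tail and Mills ratio -/

/-- The upper tail `P(Z > w)` of a standard normal variable `Z`. -/
noncomputable def normalTail (w : ℝ) : ℝ := ∫ x in Set.Ioi w, gaussianPDFReal 0 1 x

/-- The Mills ratio of the standard normal distribution: tail over density. -/
noncomputable def millsRatio (w : ℝ) : ℝ := normalTail w / gaussianPDFReal 0 1 w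

lemma stdGaussianPDF_apply (x : ℝ) :
    gaussianPDFReal 0 1 x = (√(2 * Real.pi))⁻¹ * Real.exp (-x ^ 2 / 2) := by
  simp [gaussianPDFReal]

lemma stdGaussianPDF_pos (x : ℝ) : 0 < gaussianPDFReal 0 1 x :=
  gaussianPDFReal_pos _ _ _ one_ne_zero

lemma stdGaussianPDF_neg (x : ℝ) : gaussianPDFReal 0 1 (-x) = gaussianPDFReal 0 1 x := by
  simp [stdGaussianPDF_apply]

lemma hasDerivAt_stdGaussianPDF (x : ℝ) :
    HasDerivAt (gaussianPDFReal 0 1) (-x * gaussianPDFReal 0 1 x) x := by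
  have h : HasDerivAt (fun y : ℝ => (√(2 * Real.pi))⁻¹ * Real.exp (-y ^ 2 / 2))
      ((√(2 * Real.pi))⁻¹ * (Real.exp (-x ^ 2 / 2) * (-(2 * x) / 2))) x := by
    have h1 : HasDerivAt (fun y : ℝ => -y ^ 2 / 2) (-(2 * x) / 2) x := by
      simpa using ((hasDerivAt_pow 2 x).neg.div_const 2)
    exact (h1.exp).const_mul _
  have e : gaussianPDFReal 0 1 = fun y : ℝ => (√(2 * Real.pi))⁻¹ * Real.exp (-y ^ 2 / 2) :=
    funext stdGaussianPDF_apply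
  rw [e]
  convert h using 1
  ring

lemma continuous_stdGaussianPDF : Continuous (gaussianPDFReal 0 1) :=
  continuous_iff_continuousAt.2 fun x => (hasDerivAt_stdGaussianPDF x).continuousAt

lemma tendsto_stdGaussianPDF_atTop :
    Filter.Tendsto (gaussianPDFReal 0 1) Filter.atTop (nhds 0) := by
  have e : gaussianPDFReal 0 1 = fun y : ℝ => (√(2 * Real.pi))⁻¹ * Real.exp (-(y ^ 2 / 2)) := by
    funext y; rw [stdGaussianPDF_apply, neg_div]
  rw [e]
  have h : Filter.Tendsto (fun y : ℝ => y ^ 2 / 2) Filter.atTop Filter.atTop :=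
    (Filter.tendsto_pow_atTop two_ne_zero).atTop_div_const two_pos
  simpa using (Real.tendsto_exp_neg_atTop_nhds_zero.comp h).const_mul (√(2 * Real.pi))⁻¹

lemma gaussianReal_real_Ioi (w : ℝ) : (gaussianReal 0 1).real (Set.Ioi w) = normalTail w := by
  rw [measureReal_def, gaussianReal_apply_eq_integral _ one_ne_zero, ENNReal.toReal_ofReal]
  · rfl
  · exact integral_nonneg fun x => (stdGaussianPDF_pos x).le

lemma normalTail_nonneg (w : ℝ) : 0 ≤ normalTail w := by
  rw [← gaussianReal_real_Ioi]; positivity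

lemma normalTail_anti {a b : ℝ} (h : a ≤ b) : normalTail b ≤ normalTail a := by
  rw [← gaussianReal_real_Ioi, ← gaussianReal_real_Ioi]
  exact measureReal_mono (Set.Ioi_subset_Ioi h)

lemma normalTail_add_neg (w : ℝ) : normalTail w + normalTail (-w) = 1 := by
  have h1 : normalTail (-w) = ∫ x in Set.Iic w, gaussianPDFReal 0 1 x := by
    have := integral_comp_neg_Ioi (-w) (gaussianPDFReal 0 1)
    simpa [normalTail, stdGaussianPDF_neg] using this
  have h2 := setIntegral_union (μ := volume) (f := gaussianPDFReal 0 1)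
    (Set.Iic_disjoint_Ioi (le_refl w)) measurableSet_Ioi
    (integrable_gaussianPDFReal 0 1).integrableOn (integrable_gaussianPDFReal 0 1).integrableOn
  rw [Set.Iic_union_Ioi, setIntegral_univ, integral_gaussianPDFReal_eq_one 0 one_ne_zero] at h2
  rw [h1, normalTail, h2, add_comm]

lemma normalTail_le_one (w : ℝ) : normalTail w ≤ 1 := by
  linarith [normalTail_add_neg w, normalTail_nonneg (-w)]

lemma hasDerivAt_normalTail (w : ℝ) :
    HasDerivAt normalTail (-gaussianPDFReal 0 1 w) w := by
  have e : normalTail = fun y => normalTail 0 - ∫ x in (0 : ℝ)..y, gaussianPDFReal 0 1 x := by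
    funext y
    have := intervalIntegral.integral_Ioi_sub_Ioi' (μ := volume) (f := gaussianPDFReal 0 1)
      (a := 0) (b := y)
      (integrable_gaussianPDFReal 0 1).integrableOn (integrable_gaussianPDFReal 0 1).integrableOn
    rw [← this, normalTail, normalTail]; ring
  rw [e]
  have := (continuous_stdGaussianPDF.integral_hasStrictDerivAt 0 w).hasDerivAt
  simpa using this.const_sub (normalTail 0)

/-- Shift the tail to start at 0: for x, w ≥ 0 the cross term exp(-wx) is at most 1, so the density
at x + w is dominated by a product of densities, and half the normal mass lies above 0. -/
lemma normalTail_le_mul_pdf {w : ℝ} (hw : 0 ≤ w) :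
    normalTail w ≤ √(2 * Real.pi) / 2 * gaussianPDFReal 0 1 w := by
  have h0 : normalTail 0 = 1 / 2 := by
    have := normalTail_add_neg 0
    rw [neg_zero] at this; linarith
  have h1 : normalTail w = ∫ x in Set.Ioi (0 : ℝ), gaussianPDFReal 0 1 (x + w) := by
    have := (measurePreserving_add_right volume w).setIntegral_preimage_emb
      (measurableEmbedding_addRight w) (gaussianPDFReal 0 1) (Set.Ioi w)
    simpa [normalTail] using this.symm
  have hs : 0 < √(2 * Real.pi) := by positivity
  have h2 : ∀ x ∈ Set.Ioi (0 : ℝ), gaussianPDFReal 0 1 (x + w) ≤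
      √(2 * Real.pi) * gaussianPDFReal 0 1 w * gaussianPDFReal 0 1 x := by
    intro x hx
    simp only [stdGaussianPDF_apply]
    have : √(2 * Real.pi) * ((√(2 * Real.pi))⁻¹ * Real.exp (-w ^ 2 / 2)) *
        ((√(2 * Real.pi))⁻¹ * Real.exp (-x ^ 2 / 2)) =
        (√(2 * Real.pi))⁻¹ * Real.exp (-w ^ 2 / 2 + -x ^ 2 / 2) := by
      rw [Real.exp_add]; field_simp
    rw [this]
    gcongr
    nlinarith [mul_nonneg hw (le_of_lt (Set.mem_Ioi.1 hx))]
  calc normalTail w = ∫ x in Set.Ioi (0 : ℝ), gaussianPDFReal 0 1 (x + w) := h1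
    _ ≤ ∫ x in Set.Ioi (0 : ℝ), √(2 * Real.pi) * gaussianPDFReal 0 1 w * gaussianPDFReal 0 1 x :=
        setIntegral_mono_on ((integrable_gaussianPDFReal 0 1).comp_add_right w).integrableOn
          ((integrable_gaussianPDFReal 0 1).const_mul _).integrableOn measurableSet_Ioi h2
    _ = √(2 * Real.pi) * gaussianPDFReal 0 1 w * normalTail 0 := by
        rw [integral_const_mul, normalTail]
    _ = _ := by rw [h0]; ring

/-- For w > 0, replace w by x under the integral; x times the density has minus the density as
primitive. -/
lemma mul_normalTail_le_pdf (w : ℝ) : w * normalTail w ≤ gaussianPDFReal 0 1 w := by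
  rcases le_or_gt w 0 with hw | hw
  · exact (mul_nonpos_of_nonpos_of_nonneg hw (normalTail_nonneg w)).trans (stdGaussianPDF_pos w).le
  have hd : ∀ x ∈ Set.Ici w, HasDerivAt (fun y => -gaussianPDFReal 0 1 y)
      (x * gaussianPDFReal 0 1 x) x := fun x _ => by
    have := (hasDerivAt_stdGaussianPDF x).neg
    rw [neg_mul, neg_neg] at this
    exact this
  have hpos : ∀ x ∈ Set.Ioi w, 0 ≤ x * gaussianPDFReal 0 1 x := fun x hx =>
    mul_nonneg (hw.le.trans (le_of_lt hx)) (stdGaussianPDF_pos x).le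
  have ht : Filter.Tendsto (fun y => -gaussianPDFReal 0 1 y) Filter.atTop (nhds 0) := by
    simpa using tendsto_stdGaussianPDF_atTop.neg
  have hi := integrableOn_Ioi_deriv_of_nonneg' hd hpos ht
  have he := integral_Ioi_of_hasDerivAt_of_tendsto' hd hi ht
  calc w * normalTail w = ∫ x in Set.Ioi w, w * gaussianPDFReal 0 1 x := by
        rw [integral_const_mul, normalTail]
    _ ≤ ∫ x in Set.Ioi w, x * gaussianPDFReal 0 1 x :=
        setIntegral_mono_on ((integrable_gaussianPDFReal 0 1).const_mul _).integrableOn hi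
          measurableSet_Ioi fun x hx =>
            mul_le_mul_of_nonneg_right (le_of_lt hx) (stdGaussianPDF_pos x).le
    _ = gaussianPDFReal 0 1 w := by rw [he]; ring

lemma millsRatio_nonneg (w : ℝ) : 0 ≤ millsRatio w :=
  div_nonneg (normalTail_nonneg w) (stdGaussianPDF_pos w).le

lemma mul_millsRatio_le_one (w : ℝ) : w * millsRatio w ≤ 1 := by
  rw [millsRatio, ← mul_div_assoc, div_le_one (stdGaussianPDF_pos w)]
  exact mul_normalTail_le_pdf w

lemma millsRatio_le {w : ℝ} (hw : 0 ≤ w) : millsRatio w ≤ 1.26 := by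
  rw [millsRatio, div_le_iff₀ (stdGaussianPDF_pos w)]
  refine (normalTail_le_mul_pdf hw).trans ?_
  refine mul_le_mul_of_nonneg_right ?_ (stdGaussianPDF_pos w).le
  -- 1.26 is √(2π)/2 ≈ 1.2533 rounded up.
  rw [div_le_iff₀ two_pos, Real.sqrt_le_left (by norm_num)]
  linarith [Real.pi_lt_d2]

lemma hasDerivAt_millsRatio (w : ℝ) : HasDerivAt millsRatio (w * millsRatio w - 1) w := by
  have h := (hasDerivAt_normalTail w).div (hasDerivAt_stdGaussianPDF w) (stdGaussianPDF_pos w).ne'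
  have hp := (stdGaussianPDF_pos w).ne'
  refine HasDerivAt.congr_deriv (f := millsRatio) h ?_
  rw [millsRatio]
  field_simp
  ring

lemma normalTail_mul_millsRatio_neg_le {w z : ℝ} (h : w ≤ z) :
    normalTail z * millsRatio (-w) ≤ 1.26 := by
  rcases le_or_gt w 0 with hw | hw
  · calc normalTail z * millsRatio (-w) ≤ 1 * 1.26 :=
        mul_le_mul (normalTail_le_one z) (millsRatio_le (by linarith)) (millsRatio_nonneg _) zero_le_one
      _ = 1.26 := one_mul _
  · calc normalTail z * millsRatio (-w) ≤ normalTail w * millsRatio (-w) :=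
        mul_le_mul_of_nonneg_right (normalTail_anti h) (millsRatio_nonneg _)
      _ = normalTail (-w) * millsRatio w := by
        rw [millsRatio, millsRatio, stdGaussianPDF_neg]; ring
      _ ≤ 1 * 1.26 :=
        mul_le_mul (normalTail_le_one _) (millsRatio_le hw.le) (millsRatio_nonneg _) zero_le_one
      _ = 1.26 := one_mul _

lemma normalTail_mul_one_add_nonneg (w z : ℝ) :
    0 ≤ normalTail z * (1 + w * millsRatio (-w)) :=
  mul_nonneg (normalTail_nonneg z) (by linarith [mul_millsRatio_le_one (-w)])

/-- The left side is f'(w) on the branch w ≤ z of Stein's solution; the other branch is its negative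
after reflecting w and z. For w > 0 the worst case is z = w, where w times the Mills ratio is at
most 1 and the two tails add up to 1. -/
lemma normalTail_mul_one_add_le_one {w z : ℝ} (h : w ≤ z) :
    normalTail z * (1 + w * millsRatio (-w)) ≤ 1 := by
  have h0 : 0 ≤ 1 + w * millsRatio (-w) := by linarith [mul_millsRatio_le_one (-w)]
  rcases le_or_gt w 0 with hw | hw
  · have h1 : 1 + w * millsRatio (-w) ≤ 1 := by
      linarith [mul_nonpos_of_nonpos_of_nonneg hw (millsRatio_nonneg (-w))]
    exact mul_le_one₀ (normalTail_le_one z) h0 h1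
  · calc normalTail z * (1 + w * millsRatio (-w)) ≤ normalTail w * (1 + w * millsRatio (-w)) :=
        mul_le_mul_of_nonneg_right (normalTail_anti h) h0
      _ = normalTail w + (w * millsRatio w) * normalTail (-w) := by
        rw [millsRatio, millsRatio, stdGaussianPDF_neg]; ring
      _ ≤ normalTail w + 1 * normalTail (-w) := by
        gcongr
        · exact normalTail_nonneg _
        · exact mul_millsRatio_le_one w
      _ = 1 := by rw [one_mul, normalTail_add_neg]

/-! ### Stein's equation for a half-line -/

/-- The bounded solution `f` of Stein's equation `f'(w) - w f(w) = 1{w ≤ z} - P(Z ≤ z)`. -/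
noncomputable def steinSolution (z w : ℝ) : ℝ :=
  if w ≤ z then normalTail z * millsRatio (-w) else normalTail (-z) * millsRatio w

/-- The function `w f(w) + 1{w ≤ z}`, which is `f' + P(Z ≤ z)` for Stein's solution `f`. -/
noncomputable def steinKernel (z w : ℝ) : ℝ :=
  w * steinSolution z w + (Set.Iic z).indicator 1 w

lemma steinSolution_nonneg (z w : ℝ) : 0 ≤ steinSolution z w := by
  unfold steinSolution
  split_ifs <;> exact mul_nonneg (normalTail_nonneg _) (millsRatio_nonneg _)

lemma steinSolution_le (z w : ℝ) : steinSolution z w ≤ 1.26 := by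
  unfold steinSolution
  split_ifs with h
  · exact normalTail_mul_millsRatio_neg_le h
  · simpa using normalTail_mul_millsRatio_neg_le (w := -w) (z := -z) (by linarith)

lemma abs_steinSolution_le (z w : ℝ) : |steinSolution z w| ≤ 1.26 := by
  rw [abs_of_nonneg (steinSolution_nonneg z w)]; exact steinSolution_le z w

lemma continuous_millsRatio : Continuous millsRatio :=
  continuous_iff_continuousAt.2 fun x => (hasDerivAt_millsRatio x).continuousAt

lemma continuous_steinSolution (z : ℝ) : Continuous (steinSolution z) := by
  unfold steinSolution
  refine Continuous.if_le (continuous_const.mul (continuous_millsRatio.comp continuous_neg))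
    (continuous_const.mul continuous_millsRatio) continuous_id continuous_const ?_
  rintro x rfl
  simp only [millsRatio, stdGaussianPDF_neg]
  ring

lemma abs_steinKernel_sub_le (z w : ℝ) : |steinKernel z w - normalTail (-z)| ≤ 1 := by
  unfold steinKernel steinSolution
  by_cases h : w ≤ z
  · have e : w * (normalTail z * millsRatio (-w)) + 1 - normalTail (-z)
        = normalTail z * (1 + w * millsRatio (-w)) := by
      linear_combination -normalTail_add_neg z
    rw [if_pos h, Set.indicator_of_mem (Set.mem_Iic.2 h), Pi.one_apply]
    rw [e, abs_of_nonneg (normalTail_mul_one_add_nonneg w z)]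
    exact normalTail_mul_one_add_le_one h
  · have e : w * (normalTail (-z) * millsRatio w) + 0 - normalTail (-z)
        = -(normalTail (-z) * (1 + (-w) * millsRatio (-(-w)))) := by
      rw [neg_neg]; ring
    rw [if_neg h, Set.indicator_of_notMem (by simpa using h)]
    rw [e, abs_neg, abs_of_nonneg (normalTail_mul_one_add_nonneg _ _)]
    exact normalTail_mul_one_add_le_one (by linarith)

lemma measurable_steinKernel (z : ℝ) : Measurable (steinKernel z) :=
  (measurable_id.mul (continuous_steinSolution z).measurable).add
    (measurable_one.indicator measurableSet_Iic)

lemma hasDerivAt_steinSolution {z w : ℝ} (h : w ≠ z) :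
    HasDerivAt (steinSolution z) (steinKernel z w - normalTail (-z)) w := by
  rcases lt_or_gt_of_ne h with h | h
  · have h1 : HasDerivAt (fun y => normalTail z * millsRatio (-y))
        (normalTail z * ((-w * millsRatio (-w) - 1) * -1)) w :=
      ((hasDerivAt_millsRatio (-w)).comp w (hasDerivAt_neg w)).const_mul _
    have h2 : steinSolution z =ᶠ[nhds w] fun y => normalTail z * millsRatio (-y) := by
      filter_upwards [Iio_mem_nhds h] with y hy
      simp [steinSolution, (Set.mem_Iio.1 hy).le]
    refine (h1.congr_of_eventuallyEq h2).congr_deriv ?_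
    rw [steinKernel, steinSolution, if_pos h.le, Set.indicator_of_mem (Set.mem_Iic.2 h.le), Pi.one_apply]
    linear_combination normalTail_add_neg z
  · have h1 : HasDerivAt (fun y => normalTail (-z) * millsRatio y)
        (normalTail (-z) * (w * millsRatio w - 1)) w :=
      (hasDerivAt_millsRatio w).const_mul _
    have h2 : steinSolution z =ᶠ[nhds w] fun y => normalTail (-z) * millsRatio y := by
      filter_upwards [Ioi_mem_nhds h] with y hy
      simp [steinSolution, not_le.2 (Set.mem_Ioi.1 hy)]
    refine (h1.congr_of_eventuallyEq h2).congr_deriv ?_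
    rw [steinKernel, steinSolution, if_neg h.not_ge, Set.indicator_of_notMem (by simpa using h)]
    ring

lemma intervalIntegrable_of_abs_le {g : ℝ → ℝ} (hg : Measurable g) {C : ℝ} (hC : ∀ x, |g x| ≤ C)
    (a b : ℝ) : IntervalIntegrable g volume a b :=
  (intervalIntegrable_const (c := C)).mono_fun hg.aestronglyMeasurable
    (Filter.Eventually.of_forall fun x => (hC x).trans (le_abs_self C))

lemma steinSolution_add_sub (z w x : ℝ) :
    steinSolution z (w + x) - steinSolution z w =
      ∫ t in (0 : ℝ)..x, (steinKernel z (w + t) - normalTail (-z)) := by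
  have hm : Measurable fun y => steinKernel z y - normalTail (-z) :=
    (measurable_steinKernel z).sub_const _
  -- The solution has a kink at z; continuity together with a bounded derivative off one point is
  -- enough for the fundamental theorem of calculus.
  have h := integral_eq_of_hasDerivAt_off_countable (steinSolution z)
    (fun y => steinKernel z y - normalTail (-z)) (a := w) (b := w + x) (s := {z})
    (Set.countable_singleton z) (continuous_steinSolution z).continuousOn
    (fun y hy => hasDerivAt_steinSolution (by simpa using hy.2))
    (intervalIntegrable_of_abs_le hm (abs_steinKernel_sub_le z) _ _)
  rw [← h]
  simpa using (intervalIntegral.integral_comp_add_left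
    (fun y => steinKernel z y - normalTail (-z)) w (a := 0) (b := x)).symm

lemma abs_steinSolution_add_sub_le (z w x : ℝ) :
    |steinSolution z (w + x) - steinSolution z w| ≤ |x| := by
  rw [steinSolution_add_sub]
  have := intervalIntegral.norm_integral_le_of_norm_le_const (a := (0 : ℝ)) (b := x) (C := 1)
    (f := fun t => steinKernel z (w + t) - normalTail (-z))
    (fun t _ => abs_steinKernel_sub_le z (w + t))
  simpa using this

lemma abs_mul_steinSolution_add_sub_le (z w t : ℝ) :
    |(w + t) * steinSolution z (w + t) - w * steinSolution z w| ≤ |t| * (|w| + 1.26) := by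
  have e : (w + t) * steinSolution z (w + t) - w * steinSolution z w =
      w * (steinSolution z (w + t) - steinSolution z w) + t * steinSolution z (w + t) := by ring
  rw [e]
  refine (abs_add_le _ _).trans ?_
  rw [abs_mul, abs_mul]
  have h1 := mul_le_mul_of_nonneg_left (abs_steinSolution_add_sub_le z w t) (abs_nonneg w)
  have h2 := mul_le_mul_of_nonneg_left (abs_steinSolution_le z (w + t)) (abs_nonneg t)
  linarith

/-! ### Bounded random variables, for which all integrability is automatic -/

section Bounded

variable {Ω : Type*} [MeasurableSpace Ω]

/-- A real random variable that is measurable and bounded. -/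
def BddMeasurable (f : Ω → ℝ) : Prop := Measurable f ∧ ∃ C, ∀ ω, |f ω| ≤ C

namespace BddMeasurable

variable {f g : Ω → ℝ}

lemma const (c : ℝ) : BddMeasurable (fun _ : Ω => c) := ⟨measurable_const, |c|, fun _ => le_rfl⟩

lemma add (hf : BddMeasurable f) (hg : BddMeasurable g) : BddMeasurable fun ω => f ω + g ω := by
  obtain ⟨hf, C, hC⟩ := hf
  obtain ⟨hg, D, hD⟩ := hg
  exact ⟨hf.add hg, C + D, fun ω => (abs_add_le _ _).trans (add_le_add (hC ω) (hD ω))⟩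

lemma mul (hf : BddMeasurable f) (hg : BddMeasurable g) : BddMeasurable fun ω => f ω * g ω := by
  obtain ⟨hf, C, hC⟩ := hf
  obtain ⟨hg, D, hD⟩ := hg
  refine ⟨hf.mul hg, C * D, fun ω => ?_⟩
  rw [abs_mul]
  exact mul_le_mul (hC ω) (hD ω) (abs_nonneg _) ((abs_nonneg _).trans (hC ω))

lemma neg (hf : BddMeasurable f) : BddMeasurable fun ω => -f ω :=
  ⟨hf.1.neg, hf.2.imp fun _ hC ω => (abs_neg (f ω)).trans_le (hC ω)⟩

lemma sub (hf : BddMeasurable f) (hg : BddMeasurable g) : BddMeasurable fun ω => f ω - g ω := by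
  simpa only [sub_eq_add_neg] using hf.add hg.neg

lemma abs (hf : BddMeasurable f) : BddMeasurable fun ω => |f ω| :=
  ⟨hf.1.abs, hf.2.imp fun _ hC ω => (abs_abs (f ω)).trans_le (hC ω)⟩

lemma pow (hf : BddMeasurable f) (n : ℕ) : BddMeasurable fun ω => f ω ^ n := by
  induction n with
  | zero => simpa using const 1
  | succ n ih => simpa only [pow_succ] using ih.mul hf

lemma sum {ι : Type*} {F : ι → Ω → ℝ} (s : Finset ι) (h : ∀ i ∈ s, BddMeasurable (F i)) :
    BddMeasurable fun ω => ∑ i ∈ s, F i ω := by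
  classical
  induction s using Finset.induction_on with
  | empty => simpa using const 0
  | insert i s hi ih =>
    simp only [Finset.sum_insert hi]
    exact (h i (Finset.mem_insert_self _ _)).add
      (ih fun j hj => h j (Finset.mem_insert_of_mem hj))

lemma comp_continuous (hf : BddMeasurable f) {φ : ℝ → ℝ} (hφ : Continuous φ) :
    BddMeasurable fun ω => φ (f ω) := by
  obtain ⟨hf, C, hC⟩ := hf
  obtain ⟨D, hD⟩ := (isCompact_Icc (a := -C) (b := C)).exists_bound_of_continuousOn hφ.continuousOn
  exact ⟨hφ.measurable.comp hf, D, fun ω => hD _ (Set.mem_Icc.2 (abs_le.1 (hC ω)))⟩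

lemma indicator_one {s : Set Ω} (hs : MeasurableSet s) :
    BddMeasurable (s.indicator (1 : Ω → ℝ)) := by
  refine ⟨measurable_one.indicator hs, 1, fun ω => ?_⟩
  by_cases h : ω ∈ s <;> simp [h]

lemma integrable {P : Measure Ω} [IsFiniteMeasure P] (hf : BddMeasurable f) : Integrable f P := by
  obtain ⟨hf, C, hC⟩ := hf
  exact Integrable.of_bound hf.aestronglyMeasurable C (Filter.Eventually.of_forall hC)

lemma memLp {P : Measure Ω} [IsFiniteMeasure P] (hf : BddMeasurable f) (p : ENNReal) :
    MemLp f p P := by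
  obtain ⟨hf, C, hC⟩ := hf
  exact MemLp.of_bound hf.aestronglyMeasurable C (Filter.Eventually.of_forall hC)

end BddMeasurable

end Bounded

/-! ### Truncated linear functions and concentration on intervals -/

lemma continuous_clip (r m : ℝ) : Continuous fun v : ℝ => max (-r) (min r (v - m)) := by
  fun_prop

lemma abs_clip_le {r : ℝ} (hr : 0 ≤ r) (m v : ℝ) : |max (-r) (min r (v - m))| ≤ r :=
  abs_le.2 ⟨le_max_left _ _, max_le (by linarith) (min_le_left _ _)⟩

lemma mul_clip_sub_nonneg (r m v x : ℝ) :
    0 ≤ x * (max (-r) (min r (v - m)) - max (-r) (min r (v - x - m))) := by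
  rcases le_total 0 x with hx | hx
  · refine mul_nonneg hx (sub_nonneg.2 ?_)
    gcongr
    linarith
  · refine mul_nonneg_of_nonpos_of_nonpos hx (sub_nonpos.2 ?_)
    gcongr
    linarith

/-- The truncated function has slope 1 on [a - δ, b + δ]. From v in [a, b] there is room δ on either
side, so moving by x changes the value by at least min(δ, |x|), in the direction of x. -/
lemma abs_mul_min_le_mul_clip_sub {a b δ v : ℝ} (hδ : 0 ≤ δ) (ha : a ≤ v) (hb : v ≤ b) (x : ℝ) :
    |x| * min δ |x| ≤ x * (max (-((b - a) / 2 + δ)) (min ((b - a) / 2 + δ) (v - (a + b) / 2)) -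
      max (-((b - a) / 2 + δ)) (min ((b - a) / 2 + δ) (v - x - (a + b) / 2))) := by
  have h1 : min ((b - a) / 2 + δ) (v - (a + b) / 2) = v - (a + b) / 2 := min_eq_right (by linarith)
  have h2 : max (-((b - a) / 2 + δ)) (v - (a + b) / 2) = v - (a + b) / 2 :=
    max_eq_right (by linarith)
  rw [h1, h2]
  rcases le_total 0 x with hx | hx
  · have h3 : min ((b - a) / 2 + δ) (v - x - (a + b) / 2) = v - x - (a + b) / 2 :=
      min_eq_right (by linarith)
    rw [abs_of_nonneg hx, h3]
    refine mul_le_mul_of_nonneg_left ?_ hx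
    rcases max_cases (-((b - a) / 2 + δ)) (v - x - (a + b) / 2) with h | h
    · linarith [min_le_left δ x]
    · linarith [min_le_right δ x]
  · rw [abs_of_nonpos hx]
    have h4 : max (-((b - a) / 2 + δ)) (min ((b - a) / 2 + δ) (v - x - (a + b) / 2)) =
        min ((b - a) / 2 + δ) (v - x - (a + b) / 2) :=
      max_eq_right (le_min (by linarith) (by linarith))
    rw [h4]
    have h5 : min δ (-x) ≤
        min ((b - a) / 2 + δ) (v - x - (a + b) / 2) - (v - (a + b) / 2) := by
      rcases min_cases ((b - a) / 2 + δ) (v - x - (a + b) / 2) with h | h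
      · linarith [min_le_left δ (-x)]
      · linarith [min_le_right δ (-x)]
    nlinarith

/-- After division by x, the nontrivial case is x - δ ≤ x²/(4δ), which is (x - 2δ)² ≥ 0. It turns
truncated second moments into second minus third moments. -/
lemma sq_sub_cube_div_le_mul_min {x δ : ℝ} (hx : 0 ≤ x) (hδ : 0 < δ) :
    x ^ 2 - x ^ 3 / (4 * δ) ≤ x * min δ x := by
  have h : x - x ^ 2 / (4 * δ) ≤ min δ x := by
    refine le_min ?_ ?_
    · rw [sub_le_iff_le_add, ← sub_le_iff_le_add', le_div_iff₀ (by positivity)]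
      nlinarith [sq_nonneg (x - 2 * δ)]
    · have : 0 ≤ x ^ 2 / (4 * δ) := by positivity
      linarith
  calc x ^ 2 - x ^ 3 / (4 * δ) = x * (x - x ^ 2 / (4 * δ)) := by ring
    _ ≤ _ := mul_le_mul_of_nonneg_left h hx

section Concentration

variable {Ω ι : Type*} [MeasurableSpace Ω] {P : Measure Ω} {X : ι → Ω → ℝ}

lemma indepFun_sum_of_notMem (hind : iIndepFun X P) (hX : ∀ i, BddMeasurable (X i))
    {s : Finset ι} {i : ι} (hi : i ∉ s) : IndepFun (fun ω => ∑ j ∈ s, X j ω) (X i) P := by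
  have h := hind.indepFun_finsetSum_of_notMem (fun i => (hX i).1) hi
  have e : (∑ j ∈ s, X j) = fun ω => ∑ j ∈ s, X j ω := by
    funext ω; simp
  rwa [e] at h

lemma integral_mul_comp_of_indepFun_of_integral_eq_zero {Y V : Ω → ℝ} (hY : BddMeasurable Y)
    (hV : BddMeasurable V) (h : IndepFun V Y P) (h0 : ∫ ω, Y ω ∂P = 0) {φ : ℝ → ℝ}
    (hφ : Continuous φ) : ∫ ω, Y ω * φ (V ω) ∂P = 0 := by
  have h1 : IndepFun Y (fun ω => φ (V ω)) P :=
    (h.symm).comp (φ := id) (ψ := φ) measurable_id hφ.measurable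
  rw [h1.integral_fun_mul_eq_mul_integral hY.1.aestronglyMeasurable
    (hφ.measurable.comp hV.1).aestronglyMeasurable, h0, zero_mul]

variable [IsProbabilityMeasure P]

lemma integral_sum_sq_le_one (hind : iIndepFun X P) (hX : ∀ i, BddMeasurable (X i))
    (h0 : ∀ i, ∫ ω, X i ω ∂P = 0) {s : Finset ι} (hs : ∑ i ∈ s, ∫ ω, X i ω ^ 2 ∂P ≤ 1) :
    ∫ ω, (∑ i ∈ s, X i ω) ^ 2 ∂P ≤ 1 := by
  have hmean : ∫ ω, (∑ i ∈ s, X i ω) ∂P = 0 := by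
    rw [integral_finsetSum _ fun i _ => (hX i).integrable]
    simp [h0]
  have e : (∑ j ∈ s, X j) = fun ω => ∑ j ∈ s, X j ω := by
    funext ω; simp
  have h := IndepFun.variance_sum (s := s) (fun i _ => (hX i).memLp (P := P) 2)
    (fun i _ j _ hij => hind.indepFun hij)
  rw [e, variance_of_integral_eq_zero
    (BddMeasurable.sum s fun i _ => hX i).1.aemeasurable hmean] at h
  rw [h]
  refine le_trans (le_of_eq ?_) hs
  exact Finset.sum_congr rfl fun i _ =>
    variance_of_integral_eq_zero (hX i).1.aemeasurable (h0 i)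

lemma integral_abs_le_one {Y : Ω → ℝ} (hY : BddMeasurable Y) (h : ∫ ω, Y ω ^ 2 ∂P ≤ 1) :
    ∫ ω, |Y ω| ∂P ≤ 1 := by
  have h1 : ∫ ω, |Y ω| ∂P ≤ ∫ ω, (1 + Y ω ^ 2) / 2 ∂P := by
    refine integral_mono hY.abs.integrable
      (((integrable_const 1).add (hY.pow 2).integrable).div_const 2) fun ω => ?_
    change |Y ω| ≤ (1 + Y ω ^ 2) / 2
    nlinarith [sq_nonneg (|Y ω| - 1), sq_abs (Y ω)]
  rw [integral_div, integral_add (integrable_const 1) (hY.pow 2).integrable] at h1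
  simp only [integral_const, probReal_univ, smul_eq_mul, one_mul] at h1
  linarith

/-- Evaluate E V F(V) for the truncated linear F in two ways. It is at most sup |F|, since E|V| ≤ 1.
By independence it is also E ∑ X_i (F(V) - F(V - X_i)), whose terms are nonnegative and, when V lies
in [a, b], add up to at least U = ∑ |X_i| min(δ, |X_i|); and U is close to its mean. -/
lemma measure_sum_mem_Icc_mul_le (hind : iIndepFun X P) (hX : ∀ i, BddMeasurable (X i))
    (h0 : ∀ i, ∫ ω, X i ω ∂P = 0) {s : Finset ι} (hs : ∑ i ∈ s, ∫ ω, X i ω ^ 2 ∂P ≤ 1)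
    {a b δ : ℝ} (hab : a ≤ b) (hδ : 0 < δ) :
    P.real {ω | ∑ i ∈ s, X i ω ∈ Set.Icc a b} *
      (∑ i ∈ s, ∫ ω, |X i ω| * min δ |X i ω| ∂P - δ) ≤ (b - a) / 2 + δ + δ / 4 := by
  classical
  set V : Ω → ℝ := fun ω => ∑ i ∈ s, X i ω with hVdef
  have hV : BddMeasurable V := BddMeasurable.sum s fun i _ => hX i
  set r := (b - a) / 2 + δ with hr
  have hr0 : 0 ≤ r := by rw [hr]; linarith
  set F : ℝ → ℝ := fun v => max (-r) (min r (v - (a + b) / 2)) with hF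
  have hFc : Continuous F := continuous_clip r _
  set A : Set Ω := {ω | V ω ∈ Set.Icc a b} with hA
  have hAm : MeasurableSet A := hV.1 measurableSet_Icc
  set u : ι → Ω → ℝ := fun i ω => |X i ω| * min δ |X i ω| with hu
  have huc : Continuous fun x : ℝ => |x| * min δ |x| := by fun_prop
  have hub : ∀ i, BddMeasurable (u i) := fun i => (hX i).comp_continuous huc
  set U : Ω → ℝ := fun ω => ∑ i ∈ s, u i ω with hUdef
  have hU : BddMeasurable U := BddMeasurable.sum s fun i _ => hub i
  set e := ∑ i ∈ s, ∫ ω, u i ω ∂P with he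
  have hUe : ∫ ω, U ω ∂P = e := integral_finsetSum _ fun i _ => (hub i).integrable
  have hI : BddMeasurable (A.indicator (1 : Ω → ℝ)) := BddMeasurable.indicator_one hAm
  -- upper bound
  have up : ∫ ω, V ω * F (V ω) ∂P ≤ r := by
    calc ∫ ω, V ω * F (V ω) ∂P ≤ ∫ ω, |V ω| * r ∂P := by
          refine integral_mono (hV.mul (hV.comp_continuous hFc)).integrable
            (hV.abs.mul (BddMeasurable.const r)).integrable fun ω => ?_
          refine (le_abs_self _).trans ?_
          rw [abs_mul]
          exact mul_le_mul_of_nonneg_left (abs_clip_le hr0 _ _) (abs_nonneg _)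
      _ = (∫ ω, |V ω| ∂P) * r := integral_mul_const _ _
      _ ≤ 1 * r := mul_le_mul_of_nonneg_right
          (integral_abs_le_one hV (integral_sum_sq_le_one hind hX h0 hs)) hr0
      _ = r := one_mul r
  -- lower bound
  have hVi : ∀ i, BddMeasurable fun ω => V ω - X i ω := fun i => hV.sub (hX i)
  have split : ∫ ω, V ω * F (V ω) ∂P =
      ∫ ω, ∑ i ∈ s, X i ω * (F (V ω) - F (V ω - X i ω)) ∂P := by
    -- X_i is centred and independent of V - X_i, so these terms may be subtracted freely.
    have e1 : ∀ i ∈ s, ∫ ω, X i ω * F (V ω - X i ω) ∂P = 0 := by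
      intro i hi
      have e2 : (fun ω => V ω - X i ω) = fun ω => ∑ j ∈ s.erase i, X j ω := by
        funext ω
        simp only [hVdef]
        rw [← Finset.add_sum_erase s (fun j => X j ω) hi]; ring
      refine integral_mul_comp_of_indepFun_of_integral_eq_zero (V := fun ω => V ω - X i ω)
        (hX i) (hVi i) ?_ (h0 i) hFc
      rw [e2]
      exact indepFun_sum_of_notMem hind hX (Finset.notMem_erase i s)
    have e3 : ∀ ω, ∑ i ∈ s, X i ω * (F (V ω) - F (V ω - X i ω)) =
        V ω * F (V ω) - ∑ i ∈ s, X i ω * F (V ω - X i ω) := fun ω => by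
      simp only [mul_sub, Finset.sum_sub_distrib, ← Finset.sum_mul, hVdef]
    have hi1 : ∀ i ∈ s, Integrable (fun ω => X i ω * F (V ω - X i ω)) P := fun i _ =>
      ((hX i).mul ((hVi i).comp_continuous hFc)).integrable
    simp only [e3]
    rw [integral_sub (hV.mul (hV.comp_continuous hFc)).integrable (integrable_finsetSum _ hi1),
      integral_finsetSum _ hi1, Finset.sum_eq_zero e1, sub_zero]
  have hD : BddMeasurable fun ω => U ω - e := hU.sub (BddMeasurable.const e)
  have low : ∀ ω, A.indicator (1 : Ω → ℝ) ω * (e - δ) - (U ω - e) ^ 2 / (4 * δ) ≤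
      ∑ i ∈ s, X i ω * (F (V ω) - F (V ω - X i ω)) := by
    intro ω
    by_cases hω : ω ∈ A
    · rw [Set.indicator_of_mem hω, Pi.one_apply, one_mul]
      have h1 : U ω ≤ ∑ i ∈ s, X i ω * (F (V ω) - F (V ω - X i ω)) :=
        Finset.sum_le_sum fun i _ => abs_mul_min_le_mul_clip_sub hδ.le hω.1 hω.2 (X i ω)
      refine le_trans ?_ h1
      rw [sub_le_comm, le_div_iff₀ (by positivity)]
      -- U ≥ e - δ - (U - e)²/(4δ) is a completed square. The quadratic loss is integrated over the
      -- whole space, so no independence between U and the event is needed.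
      nlinarith [sq_nonneg (U ω - e + 2 * δ)]
    · rw [Set.indicator_of_notMem hω, zero_mul, zero_sub]
      refine le_trans (neg_nonpos.2 (by positivity)) ?_
      exact Finset.sum_nonneg fun i _ => mul_clip_sub_nonneg _ _ _ _
  have hvar : ∫ ω, (U ω - e) ^ 2 ∂P ≤ δ ^ 2 := by
    have h1 : ∫ ω, (U ω - e) ^ 2 ∂P = variance U P := by
      rw [variance_eq_integral hU.1.aemeasurable, hUe]
    have h2 := IndepFun.variance_sum (s := s) (fun i _ => (hub i).memLp (P := P) 2)
      (fun i _ j _ hij => (hind.indepFun hij).comp huc.measurable huc.measurable)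
    have e1 : (∑ j ∈ s, u j) = U := by
      funext ω; simp [hUdef]
    rw [e1] at h2
    rw [h1, h2]
    calc ∑ i ∈ s, variance (u i) P ≤ ∑ i ∈ s, δ ^ 2 * ∫ ω, X i ω ^ 2 ∂P := by
          refine Finset.sum_le_sum fun i _ => ?_
          refine (variance_le_expectation_sq (hub i).1.aestronglyMeasurable).trans ?_
          rw [← integral_const_mul]
          refine integral_mono ((hub i).pow 2).integrable
            ((BddMeasurable.const _).mul ((hX i).pow 2)).integrable fun ω => ?_
          change (|X i ω| * min δ |X i ω|) ^ 2 ≤ δ ^ 2 * X i ω ^ 2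
          rw [mul_pow, sq_abs, mul_comm]
          gcongr
          exact min_le_left _ _
      _ = δ ^ 2 * ∑ i ∈ s, ∫ ω, X i ω ^ 2 ∂P := by rw [Finset.mul_sum]
      _ ≤ δ ^ 2 * 1 := by gcongr
      _ = δ ^ 2 := mul_one _
  have hint : ∫ ω, (A.indicator (1 : Ω → ℝ) ω * (e - δ) - (U ω - e) ^ 2 / (4 * δ)) ∂P =
      P.real A * (e - δ) - (∫ ω, (U ω - e) ^ 2 ∂P) / (4 * δ) := by
    rw [integral_sub (hI.mul (BddMeasurable.const _)).integrable
      ((hD.pow 2).integrable.div_const _), integral_mul_const, integral_div,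
      integral_indicator_one hAm]
  have hfin := integral_mono (μ := P)
    ((hI.mul (BddMeasurable.const (e - δ))).integrable.sub ((hD.pow 2).integrable.div_const (4 * δ)))
    (BddMeasurable.sum s fun i _ =>
      (hX i).mul ((hV.comp_continuous hFc).sub ((hVi i).comp_continuous hFc))).integrable low
  have hfin' : P.real A * (e - δ) - (∫ ω, (U ω - e) ^ 2 ∂P) / (4 * δ) ≤ r := by
    rw [← hint]
    exact hfin.trans (split ▸ up)
  have h5 : (∫ ω, (U ω - e) ^ 2 ∂P) / (4 * δ) ≤ δ / 4 := by
    rw [div_le_iff₀ (by positivity)]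
    nlinarith
  linarith

end Concentration

/-! ### Leaving one summand out of Stein's identity -/

section LeaveOneOut

variable {Ω : Type*} [MeasurableSpace Ω] {P : Measure Ω} [IsProbabilityMeasure P]

lemma integral_eq_integral_integral_of_indepFun {Y V : Ω → ℝ} (hY : Measurable Y)
    (hV : Measurable V) (h : IndepFun V Y P) {φ : ℝ → ℝ → ℝ}
    (hφ : Measurable (Function.uncurry φ)) (hi : Integrable (fun ω => φ (Y ω) (V ω)) P) :
    ∫ ω, φ (Y ω) (V ω) ∂P = ∫ ω, ∫ ω', φ (Y ω) (V ω') ∂P ∂P := by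
  have hmap := h.symm.map_prod_eq_prod_map_map hY.aemeasurable hV.aemeasurable
  have hYV : Measurable fun ω => (Y ω, V ω) := hY.prodMk hV
  have h1 : ∫ ω, φ (Y ω) (V ω) ∂P = ∫ p, Function.uncurry φ p ∂(P.map fun ω => (Y ω, V ω)) :=
    (integral_map hYV.aemeasurable hφ.aestronglyMeasurable).symm
  have h2 : Integrable (Function.uncurry φ) ((P.map Y).prod (P.map V)) := by
    rw [← hmap]
    exact (integrable_map_measure hφ.aestronglyMeasurable hYV.aemeasurable).2 hi
  have := Measure.isProbabilityMeasure_map (μ := P) hY.aemeasurable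
  have := Measure.isProbabilityMeasure_map (μ := P) hV.aemeasurable
  rw [h1, hmap, integral_prod _ h2, integral_map hY.aemeasurable
    h2.aestronglyMeasurable.integral_prod_right']
  refine integral_congr_ae (Filter.Eventually.of_forall fun ω => ?_)
  exact integral_map hV.aemeasurable (hφ.comp measurable_prodMk_left).aestronglyMeasurable

lemma abs_intervalIntegral_le_of_abs_le_affine {g : ℝ → ℝ} {A B : ℝ}
    (hg : ∀ t, |g t| ≤ A * |t| + B) (x : ℝ) :
    |∫ t in (0 : ℝ)..x, g t| ≤ A * (x ^ 2 / 2) + B * |x| := by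
  have key : ∀ {g : ℝ → ℝ}, (∀ t, |g t| ≤ A * |t| + B) → ∀ x, 0 ≤ x →
      |∫ t in (0 : ℝ)..x, g t| ≤ A * (x ^ 2 / 2) + B * |x| := by
    intro g hg x hx
    have h := intervalIntegral.norm_integral_le_of_norm_le (μ := volume) (f := g)
      (g := fun t => A * t + B) hx
      (Filter.Eventually.of_forall fun t ht => by
        have := hg t
        rwa [abs_of_pos ht.1] at this)
      ((by fun_prop : Continuous fun t : ℝ => A * t + B).intervalIntegrable 0 x)
    rw [intervalIntegral.integral_add ((by fun_prop : Continuous fun t : ℝ => A * t).intervalIntegrable 0 x)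
      intervalIntegrable_const, intervalIntegral.integral_const_mul, integral_id,
      intervalIntegral.integral_const, Real.norm_eq_abs] at h
    rw [abs_of_nonneg hx]
    simp only [sub_zero, smul_eq_mul] at h
    linarith
  rcases le_total 0 x with hx | hx
  · exact key hg x hx
  · have h := key (g := fun t => g (-t)) (fun t => by simpa using hg (-t)) (-x) (by linarith)
    have e : ∫ t in (0 : ℝ)..(-x), g (-t) = -∫ t in (0 : ℝ)..x, g t := by
      rw [intervalIntegral.integral_comp_neg (fun t => g t)]
      simp [intervalIntegral.integral_symm x 0]
    rw [e] at h
    simpa using h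

lemma BddMeasurable.comp_of_abs_sub_le {Y : Ω → ℝ} (hY : BddMeasurable Y) {g : ℝ → ℝ}
    (hg : Measurable g) {A B : ℝ} (hA : 0 ≤ A) (h : ∀ t, |g t - g 0| ≤ A * |t| + B) :
    BddMeasurable fun ω => g (Y ω) := by
  obtain ⟨hYm, C, hC⟩ := hY
  refine ⟨hg.comp hYm, A * C + B + |g 0|, fun ω => ?_⟩
  have h1 := h (Y ω)
  have h2 := mul_le_mul_of_nonneg_left (hC ω) hA
  have h3 := abs_add_le (g (Y ω) - g 0) (g 0)
  rw [sub_add_cancel] at h3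
  linarith

/-- With c = E|Y| and y = |Y|, integrate y³ - c y² - c²(y - c) = (y - c)²(y + c) ≥ 0; the last term
on the left has mean zero. -/
lemma integral_abs_mul_integral_sq_le {Y : Ω → ℝ} (hY : BddMeasurable Y) :
    (∫ ω, |Y ω| ∂P) * ∫ ω, Y ω ^ 2 ∂P ≤ ∫ ω, |Y ω| ^ 3 ∂P := by
  set c := ∫ ω, |Y ω| ∂P with hc
  have hc0 : 0 ≤ c := integral_nonneg fun ω => abs_nonneg _
  have h1 : ∫ ω, (c * Y ω ^ 2 + c ^ 2 * (|Y ω| - c)) ∂P ≤ ∫ ω, |Y ω| ^ 3 ∂P := by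
    refine integral_mono (((BddMeasurable.const c).mul (hY.pow 2)).add
      ((BddMeasurable.const _).mul (hY.abs.sub (BddMeasurable.const c)))).integrable
      (hY.abs.pow 3).integrable fun ω => ?_
    change c * Y ω ^ 2 + c ^ 2 * (|Y ω| - c) ≤ |Y ω| ^ 3
    rw [← sq_abs (Y ω)]
    nlinarith [mul_nonneg (sq_nonneg (|Y ω| - c)) (add_nonneg (abs_nonneg (Y ω)) hc0)]
  rw [integral_add ((BddMeasurable.const c).mul (hY.pow 2)).integrable
      ((BddMeasurable.const _).mul (hY.abs.sub (BddMeasurable.const c))).integrable,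
    integral_const_mul, integral_const_mul,
    integral_sub hY.abs.integrable (integrable_const c)] at h1
  simp only [integral_const, probReal_univ, smul_eq_mul, one_mul, ← hc, sub_self, mul_zero,
    add_zero] at h1
  exact h1

lemma steinKernel_add_bddMeasurable {V : Ω → ℝ} (hV : BddMeasurable V) (z t : ℝ) :
    BddMeasurable fun ω => steinKernel z (V ω + t) := by
  refine ⟨(measurable_steinKernel z).comp (hV.1.add_const t), 1 + |normalTail (-z)|, fun ω => ?_⟩
  have := abs_add_le (steinKernel z (V ω + t) - normalTail (-z)) (normalTail (-z))
  rw [sub_add_cancel] at this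
  linarith [abs_steinKernel_sub_le z (V ω + t)]

lemma steinSolution_add_bddMeasurable {V : Ω → ℝ} (hV : BddMeasurable V) (z t : ℝ) :
    BddMeasurable fun ω => steinSolution z (V ω + t) :=
  (hV.add (BddMeasurable.const t)).comp_continuous (continuous_steinSolution z)

lemma integral_steinSolution_add_sub {V : Ω → ℝ} (hV : BddMeasurable V) (z x : ℝ) :
    ∫ ω, steinSolution z (V ω + x) ∂P - ∫ ω, steinSolution z (V ω) ∂P =
      ∫ t in (0 : ℝ)..x, (∫ ω, steinKernel z (V ω + t) ∂P - normalTail (-z)) := by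
  rw [← integral_sub (steinSolution_add_bddMeasurable hV z x).integrable
    (hV.comp_continuous (continuous_steinSolution z)).integrable]
  simp only [steinSolution_add_sub]
  rw [← intervalIntegral_integral_swap (f := fun t ω => steinKernel z (V ω + t) - normalTail (-z))]
  · refine intervalIntegral.integral_congr fun t _ => ?_
    change ∫ ω, (steinKernel z (V ω + t) - normalTail (-z)) ∂P = _
    rw [integral_sub (steinKernel_add_bddMeasurable hV z t).integrable (integrable_const _)]
    simp
  · have hm : Measurable (Function.uncurry fun (t : ℝ) ω => steinKernel z (V ω + t) - normalTail (-z)) :=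
      ((measurable_steinKernel z).comp ((hV.1.comp measurable_snd).add measurable_fst)).sub_const _
    have : IsFiniteMeasure (volume.restrict (Set.uIoc 0 x)) := by
      constructor; simp [Set.uIoc]
    exact Integrable.of_bound hm.aestronglyMeasurable 1
      (Filter.Eventually.of_forall fun p => abs_steinKernel_sub_le z _)

/-- One-summand comparison in Stein's identity. -/
lemma abs_integral_mul_steinSolution_sub_le {Y V : Ω → ℝ} (hY : BddMeasurable Y)
    (hV : BddMeasurable V) (hind : IndepFun V Y P) (h0 : ∫ ω, Y ω ∂P = 0) {z A B : ℝ}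
    (hA : 0 ≤ A) (hH : ∀ t, |∫ ω, steinKernel z (V ω + t) ∂P - ∫ ω, steinKernel z (V ω) ∂P| ≤
      A * |t| + B) :
    |∫ ω, Y ω * steinSolution z (V ω + Y ω) ∂P -
      (∫ ω, Y ω ^ 2 ∂P) * (∫ ω, steinKernel z (V ω + Y ω) ∂P - normalTail (-z))| ≤
      3 / 2 * A * ∫ ω, |Y ω| ^ 3 ∂P + 2 * B * ∫ ω, Y ω ^ 2 ∂P := by
  set H : ℝ → ℝ := fun t => ∫ ω, steinKernel z (V ω + t) ∂P with hHdef
  set F : ℝ → ℝ := fun x => ∫ ω, steinSolution z (V ω + x) ∂P with hFdef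
  have hH0 : ∀ t, |H t - H 0| ≤ A * |t| + B := by simpa [hHdef] using hH
  have hkm : Measurable (Function.uncurry fun (y v : ℝ) => steinKernel z (v + y)) :=
    (measurable_steinKernel z).comp (measurable_snd.add measurable_fst)
  have hfm : Measurable (Function.uncurry fun (y v : ℝ) => steinSolution z (v + y)) :=
    (continuous_steinSolution z).measurable.comp (measurable_snd.add measurable_fst)
  have hVY := hV.add hY
  have hHm : Measurable H := by
    have h1 : Measurable (Function.uncurry fun (t : ℝ) ω => steinKernel z (V ω + t)) :=
      (measurable_steinKernel z).comp ((hV.1.comp measurable_snd).add measurable_fst)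
    exact h1.stronglyMeasurable.integral_prod_right.measurable
  have hFm : Measurable F := by
    have h1 : Measurable (Function.uncurry fun (t : ℝ) ω => steinSolution z (V ω + t)) :=
      (continuous_steinSolution z).measurable.comp ((hV.1.comp measurable_snd).add measurable_fst)
    exact h1.stronglyMeasurable.integral_prod_right.measurable
  have hFb : ∀ x, |F x| ≤ 1.26 := fun x => by
    have := norm_integral_le_of_norm_le_const (μ := P) (f := fun ω => steinSolution z (V ω + x))
      (C := 1.26) (Filter.Eventually.of_forall fun ω => abs_steinSolution_le z _)
    simpa using this
  have hFY : BddMeasurable fun ω => F (Y ω) := ⟨hFm.comp hY.1, 1.26, fun ω => hFb _⟩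
  have hHY : BddMeasurable fun ω => H (Y ω) := hY.comp_of_abs_sub_le hHm hA hH0
  have e1 : ∫ ω, steinKernel z (V ω + Y ω) ∂P = ∫ ω, H (Y ω) ∂P :=
    integral_eq_integral_integral_of_indepFun hY.1 hV.1 hind hkm
      (by simpa using (steinKernel_add_bddMeasurable hVY z 0).integrable)
  -- Integrating out V turns f into F; subtracting F 0 costs nothing because Y is centred.
  have e2 : ∫ ω, Y ω * steinSolution z (V ω + Y ω) ∂P = ∫ ω, Y ω * (F (Y ω) - F 0) ∂P := by
    rw [integral_eq_integral_integral_of_indepFun (φ := fun y v => y * steinSolution z (v + y))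
      hY.1 hV.1 hind (measurable_fst.mul hfm)
      (hY.mul (hVY.comp_continuous (continuous_steinSolution z))).integrable]
    simp only [integral_const_mul, mul_sub]
    rw [integral_sub (hY.mul hFY).integrable (hY.mul (BddMeasurable.const _)).integrable,
      integral_mul_const, h0, zero_mul, sub_zero]
  -- F is a primitive of H - P(Z ≤ z). Freezing H at 0 leaves an integral of A|t| + B, whence the
  -- factor A / 2.
  have p1 : ∀ ω, |Y ω * (F (Y ω) - F 0) - Y ω ^ 2 * (H 0 - normalTail (-z))| ≤
      A / 2 * |Y ω| ^ 3 + B * Y ω ^ 2 := by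
    intro ω
    have hF : F (Y ω) - F 0 = ∫ t in (0 : ℝ)..Y ω, (H t - normalTail (-z)) := by
      have := integral_steinSolution_add_sub (P := P) hV z (Y ω)
      simpa [hFdef] using this
    have hint : IntervalIntegrable (fun t => H t - normalTail (-z)) volume 0 (Y ω) := by
      refine intervalIntegrable_of_abs_le (hHm.sub_const _) (C := 1) (fun t => ?_) _ _
      have e : H t - normalTail (-z) = ∫ ω, (steinKernel z (V ω + t) - normalTail (-z)) ∂P := by
        rw [integral_sub (steinKernel_add_bddMeasurable hV z t).integrable (integrable_const _)]
        simp [hHdef]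
      have := norm_integral_le_of_norm_le_const (μ := P)
        (f := fun ω => steinKernel z (V ω + t) - normalTail (-z))
        (C := 1) (Filter.Eventually.of_forall fun ω => abs_steinKernel_sub_le z _)
      rw [e]
      simpa using this
    have e : Y ω * (F (Y ω) - F 0) - Y ω ^ 2 * (H 0 - normalTail (-z)) =
        Y ω * ∫ t in (0 : ℝ)..Y ω, (H t - H 0) := by
      have e' : ∫ t in (0 : ℝ)..Y ω, (H t - H 0) =
          (∫ t in (0 : ℝ)..Y ω, (H t - normalTail (-z))) - Y ω * (H 0 - normalTail (-z)) := by
        have := intervalIntegral.integral_sub hint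
          (intervalIntegrable_const (μ := volume) (a := 0) (b := Y ω) (c := H 0 - normalTail (-z)))
        simp only [sub_sub_sub_cancel_right, intervalIntegral.integral_const, sub_zero,
          smul_eq_mul] at this
        exact this
      rw [e', hF]; ring
    rw [e, abs_mul]
    calc |Y ω| * |∫ t in (0 : ℝ)..Y ω, (H t - H 0)|
        ≤ |Y ω| * (A * (Y ω ^ 2 / 2) + B * |Y ω|) :=
          mul_le_mul_of_nonneg_left (abs_intervalIntegral_le_of_abs_le_affine hH0 _) (abs_nonneg _)
      _ = A / 2 * |Y ω| ^ 3 + B * Y ω ^ 2 := by rw [← sq_abs (Y ω)]; ring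
  have i1 : |∫ ω, Y ω * (F (Y ω) - F 0) ∂P - (∫ ω, Y ω ^ 2 ∂P) * (H 0 - normalTail (-z))| ≤
      A / 2 * ∫ ω, |Y ω| ^ 3 ∂P + B * ∫ ω, Y ω ^ 2 ∂P := by
    rw [← integral_mul_const, ← integral_sub (hY.mul (hFY.sub (BddMeasurable.const _))).integrable
      ((hY.pow 2).mul (BddMeasurable.const _)).integrable, ← integral_const_mul,
      ← integral_const_mul, ← integral_add ((BddMeasurable.const _).mul (hY.abs.pow 3)).integrable
      ((BddMeasurable.const _).mul (hY.pow 2)).integrable]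
    exact norm_integral_le_of_norm_le
      (f := fun ω => Y ω * (F (Y ω) - F 0) - Y ω ^ 2 * (H 0 - normalTail (-z)))
      (g := fun ω => A / 2 * |Y ω| ^ 3 + B * Y ω ^ 2)
      (((BddMeasurable.const _).mul (hY.abs.pow 3)).add
      ((BddMeasurable.const _).mul (hY.pow 2))).integrable (Filter.Eventually.of_forall p1)
  have i2 : |∫ ω, H (Y ω) ∂P - H 0| ≤ A * ∫ ω, |Y ω| ∂P + B := by
    have e : ∫ ω, H (Y ω) ∂P - H 0 = ∫ ω, (H (Y ω) - H 0) ∂P := by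
      rw [integral_sub hHY.integrable (integrable_const _)]; simp
    have e' : A * ∫ ω, |Y ω| ∂P + B = ∫ ω, (A * |Y ω| + B) ∂P := by
      rw [integral_add (hY.abs.integrable.const_mul A) (integrable_const _), integral_const_mul]
      simp
    rw [e, e']
    exact norm_integral_le_of_norm_le (f := fun ω => H (Y ω) - H 0)
      (g := fun ω => A * |Y ω| + B) ((hY.abs.integrable.const_mul A).add (integrable_const _))
      (Filter.Eventually.of_forall fun ω => hH0 (Y ω))
  have hs : 0 ≤ ∫ ω, Y ω ^ 2 ∂P := integral_nonneg fun ω => sq_nonneg _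
  -- Replacing the frozen H 0 by E H(Y), which is the kernel at the full sum, costs another A E|Y|³
  -- + B E Y²; this accounts for 3/2 and 2 in the conclusion.
  have i3 : |(∫ ω, Y ω ^ 2 ∂P) * (∫ ω, H (Y ω) ∂P - H 0)| ≤
      A * ∫ ω, |Y ω| ^ 3 ∂P + B * ∫ ω, Y ω ^ 2 ∂P := by
    rw [abs_mul, abs_of_nonneg hs]
    have h1 := mul_le_mul_of_nonneg_left i2 hs
    have h2 := mul_le_mul_of_nonneg_left (integral_abs_mul_integral_sq_le (P := P) hY) hA
    linarith
  rw [e1, e2]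
  rw [abs_le] at i1 i3 ⊢
  constructor <;> linarith [i1.1, i1.2, i3.1, i3.2]

end LeaveOneOut

/-! ### The Berry–Esseen inequality -/

section BerryEsseen

variable {Ω ι : Type*} [MeasurableSpace Ω] {P : Measure Ω} [IsProbabilityMeasure P]
  {X : ι → Ω → ℝ}

lemma abs_indicator_Iic_add_sub_le (z w t : ℝ) :
    |(Set.Iic z).indicator (1 : ℝ → ℝ) (w + t) - (Set.Iic z).indicator 1 w| ≤
      (Set.Icc (min z (z - t)) (max z (z - t))).indicator 1 w := by
  by_cases h1 : w + t ≤ z <;> by_cases h2 : w ≤ z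
  · rw [Set.indicator_of_mem (Set.mem_Iic.2 h1), Set.indicator_of_mem (Set.mem_Iic.2 h2)]
    rw [Pi.one_apply, Pi.one_apply, sub_self, abs_zero]
    exact Set.indicator_nonneg (fun _ _ => zero_le_one) w
  · rw [Set.indicator_of_mem (Set.mem_Iic.2 h1), Set.indicator_of_notMem (by simpa using h2),
      Set.indicator_of_mem (Set.mem_Icc.2
        ⟨(min_le_left _ _).trans (not_le.1 h2).le, le_max_of_le_right (by linarith)⟩)]
    simp
  · rw [Set.indicator_of_mem (Set.mem_Iic.2 h2), Set.indicator_of_notMem (by simpa using h1),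
      Set.indicator_of_mem (Set.mem_Icc.2
        ⟨(min_le_right _ _).trans (by linarith), le_max_of_le_left h2⟩)]
    simp
  · rw [Set.indicator_of_notMem (by simpa using h1), Set.indicator_of_notMem (by simpa using h2)]
    rw [sub_self, abs_zero]
    exact Set.indicator_nonneg (fun _ _ => zero_le_one) w

/-- The part w f(w) of the kernel moves by at most |t|(|V| + 1.26), and E|V| ≤ 1 gives 2.26. The
indicator changes only when V lies between z and z - t, an interval of length |t|, to which the
concentration hypothesis applies. -/
lemma abs_integral_steinKernel_add_sub_le {V : Ω → ℝ} (hV : BddMeasurable V)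
    (hV2 : ∫ ω, V ω ^ 2 ∂P ≤ 1) {α β : ℝ}
    (hc : ∀ a b, a ≤ b → P.real {ω | V ω ∈ Set.Icc a b} ≤ α * (b - a) + β) (z t : ℝ) :
    |∫ ω, steinKernel z (V ω + t) ∂P - ∫ ω, steinKernel z (V ω) ∂P| ≤ (α + 2.26) * |t| + β := by
  set S := {ω | V ω ∈ Set.Icc (min z (z - t)) (max z (z - t))} with hS
  have hSm : MeasurableSet S := hV.1 measurableSet_Icc
  have hSI : Integrable (S.indicator (1 : Ω → ℝ)) P := (BddMeasurable.indicator_one hSm).integrable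
  have hVI : Integrable (fun ω => |t| * (|V ω| + 1.26)) P :=
    ((BddMeasurable.const _).mul (hV.abs.add (BddMeasurable.const _))).integrable
  have pt : ∀ ω, |steinKernel z (V ω + t) - steinKernel z (V ω)| ≤
      |t| * (|V ω| + 1.26) + S.indicator 1 ω := by
    intro ω
    have e : steinKernel z (V ω + t) - steinKernel z (V ω) =
        ((V ω + t) * steinSolution z (V ω + t) - V ω * steinSolution z (V ω)) +
        ((Set.Iic z).indicator (1 : ℝ → ℝ) (V ω + t) - (Set.Iic z).indicator 1 (V ω)) := by
      unfold steinKernel; ring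
    rw [e]
    exact (abs_add_le _ _).trans
      (add_le_add (abs_mul_steinSolution_add_sub_le z _ t) (abs_indicator_Iic_add_sub_le z _ t))
  have h0 : BddMeasurable fun ω => steinKernel z (V ω) := by
    simpa using steinKernel_add_bddMeasurable hV z 0
  rw [← integral_sub (steinKernel_add_bddMeasurable hV z t).integrable h0.integrable]
  refine (norm_integral_le_of_norm_le
    (f := fun ω => steinKernel z (V ω + t) - steinKernel z (V ω))
    (g := fun ω => |t| * (|V ω| + 1.26) + S.indicator 1 ω) (hVI.add hSI) (Filter.Eventually.of_forall pt)).trans ?_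
  have e : ∫ ω, (|t| * (|V ω| + 1.26) + S.indicator (1 : Ω → ℝ) ω) ∂P =
      |t| * (∫ ω, |V ω| ∂P + 1.26) + P.real S := by
    rw [integral_add hVI hSI, integral_const_mul, integral_add hV.abs.integrable
      (integrable_const _), integral_indicator_one hSm]
    simp
  rw [e]
  have h1 := hc _ _ (min_le_max (a := z) (b := z - t))
  have h2 : max z (z - t) - min z (z - t) = |t| := by
    rw [max_sub_min_eq_abs]; simp
  rw [h2] at h1
  have h3 := mul_le_mul_of_nonneg_left (integral_abs_le_one hV hV2) (abs_nonneg t)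
  linarith

variable [Fintype ι]

lemma measure_sum_erase_mem_Icc_le [DecidableEq ι] (hind : iIndepFun X P)
    (hX : ∀ i, BddMeasurable (X i)) (h0 : ∀ i, ∫ ω, X i ω ∂P = 0)
    (h1 : ∑ i, ∫ ω, X i ω ^ 2 ∂P = 1) {γ : ℝ} (hγ : γ = ∑ i, ∫ ω, |X i ω| ^ 3 ∂P)
    (hγ0 : 0 < γ) (hγ1 : γ ≤ 5 / 47) (i : ι) {a b : ℝ} (hab : a ≤ b) :
    P.real {ω | ∑ j ∈ Finset.univ.erase i, X j ω ∈ Set.Icc a b} ≤ 1.3 * (b - a) + 1.6 * γ := by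
  have hsq : ∀ j, 0 ≤ ∫ ω, X j ω ^ 2 ∂P := fun j => integral_nonneg fun ω => sq_nonneg _
  have hs : ∑ j ∈ Finset.univ.erase i, ∫ ω, X j ω ^ 2 ∂P ≤ 1 :=
    h1 ▸ Finset.sum_le_sum_of_subset_of_nonneg (Finset.erase_subset _ _) fun j _ _ => hsq j
  have hi1 : ∫ ω, X i ω ^ 2 ∂P ≤ 1 :=
    h1 ▸ Finset.single_le_sum (fun j _ => hsq j) (Finset.mem_univ i)
  have hδ : 0 < γ / 2 := by positivity
  have hub : ∀ j, BddMeasurable fun ω => |X j ω| * min (γ / 2) |X j ω| := fun j =>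
    (hX j).comp_continuous (φ := fun x => |x| * min (γ / 2) |x|) (by fun_prop)
  have hc := measure_sum_mem_Icc_mul_le hind hX h0 hs hab hδ
  -- The choice δ = γ/2 makes the third-moment loss γ/(4δ) exactly 1/2.
  have htot : 1 / 2 ≤ ∑ j, ∫ ω, |X j ω| * min (γ / 2) |X j ω| ∂P := by
    calc (1 / 2 : ℝ) = 1 - γ / (4 * (γ / 2)) := by field_simp; norm_num
      _ = ∑ j, (∫ ω, X j ω ^ 2 ∂P - (∫ ω, |X j ω| ^ 3 ∂P) / (4 * (γ / 2))) := by
          rw [Finset.sum_sub_distrib, h1, ← Finset.sum_div, ← hγ]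
      _ ≤ _ := by
          refine Finset.sum_le_sum fun j _ => ?_
          rw [← integral_div, ← integral_sub ((hX j).pow 2).integrable
            (((hX j).abs.pow 3).integrable.div_const _)]
          refine integral_mono (((hX j).pow 2).integrable.sub
            (((hX j).abs.pow 3).integrable.div_const _)) (hub j).integrable fun ω => ?_
          have := sq_sub_cube_div_le_mul_min (abs_nonneg (X j ω)) hδ
          rwa [sq_abs] at this
  have hlast : ∫ ω, |X i ω| * min (γ / 2) |X i ω| ∂P ≤ γ / 2 := by
    calc ∫ ω, |X i ω| * min (γ / 2) |X i ω| ∂P ≤ ∫ ω, |X i ω| * (γ / 2) ∂P :=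
          integral_mono (hub i).integrable ((hX i).abs.integrable.mul_const _) fun ω =>
            mul_le_mul_of_nonneg_left (min_le_left _ _) (abs_nonneg _)
      _ = (∫ ω, |X i ω| ∂P) * (γ / 2) := integral_mul_const _ _
      _ ≤ 1 * (γ / 2) := by gcongr; exact integral_abs_le_one (hX i) hi1
      _ = γ / 2 := one_mul _
  rw [← Finset.add_sum_erase _ _ (Finset.mem_univ i)] at htot
  set p := P.real {ω | ∑ j ∈ Finset.univ.erase i, X j ω ∈ Set.Icc a b} with hp
  have hp0 : 0 ≤ p := measureReal_nonneg
  have h2 : p * (1 / 2 - γ) ≤ (b - a) / 2 + γ / 2 + γ / 2 / 4 := by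
    refine le_trans (mul_le_mul_of_nonneg_left ?_ hp0) hc
    linarith
  -- Dividing by 1/2 - 5/47 = 37/94 turns 1/2 into at most 1.3 and 5/8 into at most 1.6.
  have h3 : p * (1 / 2 - 5 / 47) ≤ p * (1 / 2 - γ) := by gcongr
  linarith

/-- **Berry–Esseen inequality** for independent bounded random variables. -/
theorem abs_measure_sum_le_sub_normalTail_le (hind : iIndepFun X P)
    (hX : ∀ i, BddMeasurable (X i)) (h0 : ∀ i, ∫ ω, X i ω ∂P = 0)
    (h1 : ∑ i, ∫ ω, X i ω ^ 2 ∂P = 1) (z : ℝ) :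
    |P.real {ω | ∑ i, X i ω ≤ z} - normalTail (-z)| ≤ 9.4 * ∑ i, ∫ ω, |X i ω| ^ 3 ∂P := by
  classical
  set γ := ∑ i, ∫ ω, |X i ω| ^ 3 ∂P with hγ
  have htriv : |P.real {ω | ∑ i, X i ω ≤ z} - normalTail (-z)| ≤ 1 :=
    abs_le.2 ⟨by linarith [measureReal_nonneg (μ := P) (s := {ω | ∑ i, X i ω ≤ z}),
      normalTail_le_one (-z)],
      by linarith [measureReal_le_one (μ := P) (s := {ω | ∑ i, X i ω ≤ z}),
      normalTail_nonneg (-z)]⟩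
  -- 5/47 = 1/9.4: for larger γ the claimed bound exceeds 1 and is trivial.
  rcases lt_or_ge (5 / 47) γ with hbig | hγ1
  · refine htriv.trans ?_
    linarith
  have hsq : ∀ j, 0 ≤ ∫ ω, X j ω ^ 2 ∂P := fun j => integral_nonneg fun ω => sq_nonneg _
  have hle1 : ∀ i, ∫ ω, X i ω ^ 2 ∂P ≤ 1 := fun i =>
    h1 ▸ Finset.single_le_sum (fun j _ => hsq j) (Finset.mem_univ i)
  have hcube : ∀ i, 0 ≤ ∫ ω, |X i ω| ^ 3 ∂P := fun i => integral_nonneg fun ω => by positivity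
  -- If γ = 0, every X_i vanishes almost surely, against the unit total variance.
  have hγ0 : 0 < γ := by
    refine lt_of_le_of_ne (Finset.sum_nonneg fun i _ => hcube i) fun h => ?_
    have hz : ∀ i, ∫ ω, X i ω ^ 2 ∂P = 0 := by
      intro i
      have h2 := (Finset.sum_eq_zero_iff_of_nonneg fun i _ => hcube i).1 h.symm i (Finset.mem_univ i)
      rw [integral_eq_zero_iff_of_nonneg (fun ω => by positivity)
        ((hX i).abs.pow 3).integrable] at h2
      refine integral_eq_zero_of_ae ?_
      filter_upwards [h2] with ω hω
      have : X i ω = 0 := by simpa using hω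
      simp [this]
    simp [hz] at h1
  set W : Ω → ℝ := fun ω => ∑ i, X i ω with hW
  have hWb : BddMeasurable W := BddMeasurable.sum _ fun i _ => hX i
  have hf : BddMeasurable fun ω => steinSolution z (W ω) :=
    hWb.comp_continuous (continuous_steinSolution z)
  -- Here A = 1.3 + 2.26 = 3.56 and B = 1.6 γ.
  have hterm : ∀ i, |∫ ω, X i ω * steinSolution z (W ω) ∂P -
      (∫ ω, X i ω ^ 2 ∂P) * (∫ ω, steinKernel z (W ω) ∂P - normalTail (-z))| ≤
      3 / 2 * 3.56 * ∫ ω, |X i ω| ^ 3 ∂P + 2 * (1.6 * γ) * ∫ ω, X i ω ^ 2 ∂P := by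
    intro i
    have hVb : BddMeasurable fun ω => ∑ j ∈ Finset.univ.erase i, X j ω :=
      BddMeasurable.sum _ fun j _ => hX j
    have hs : ∑ j ∈ Finset.univ.erase i, ∫ ω, X j ω ^ 2 ∂P ≤ 1 :=
      h1 ▸ Finset.sum_le_sum_of_subset_of_nonneg (Finset.erase_subset _ _) fun j _ _ => hsq j
    have hH := abs_integral_steinKernel_add_sub_le hVb (integral_sum_sq_le_one hind hX h0 hs)
      (fun a b hab => measure_sum_erase_mem_Icc_le hind hX h0 h1 hγ hγ0 hγ1 i hab) z
    have := abs_integral_mul_steinSolution_sub_le (hX i) hVb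
      (indepFun_sum_of_notMem hind hX (Finset.notMem_erase i _)) (h0 i) (by norm_num) hH
    simp only [Finset.sum_erase_add _ _ (Finset.mem_univ i)] at this
    norm_num at this ⊢
    exact this
  have hsum : ∑ i, ∫ ω, X i ω * steinSolution z (W ω) ∂P = ∫ ω, W ω * steinSolution z (W ω) ∂P := by
    rw [← integral_finsetSum _ fun i _ => ((hX i).mul hf).integrable]
    simp only [← Finset.sum_mul, hW]
  have hSm : MeasurableSet {ω | W ω ≤ z} := hWb.1 measurableSet_Iic
  have hk : ∫ ω, steinKernel z (W ω) ∂P =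
      ∫ ω, W ω * steinSolution z (W ω) ∂P + P.real {ω | W ω ≤ z} := by
    unfold steinKernel
    rw [← integral_indicator_one hSm, ← integral_add (hWb.mul hf).integrable
      (BddMeasurable.indicator_one hSm).integrable]
    rfl
  have e : -(P.real {ω | W ω ≤ z} - normalTail (-z)) =
      ∑ i, (∫ ω, X i ω * steinSolution z (W ω) ∂P -
        (∫ ω, X i ω ^ 2 ∂P) * (∫ ω, steinKernel z (W ω) ∂P - normalTail (-z))) := by
    rw [Finset.sum_sub_distrib, ← Finset.sum_mul, h1, hsum, hk]
    ring
  rw [← abs_neg, e]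
  refine (Finset.abs_sum_le_sum_abs _ _).trans ((Finset.sum_le_sum fun i _ => hterm i).trans ?_)
  rw [Finset.sum_add_distrib, ← Finset.mul_sum, ← Finset.mul_sum, h1, ← hγ]
  -- The total is 3/2 · 3.56 + 2 · 1.6 = 8.54 times γ.
  linarith

theorem abs_measure_le_sum_sub_normalTail_le (hind : iIndepFun X P)
    (hX : ∀ i, BddMeasurable (X i)) (h0 : ∀ i, ∫ ω, X i ω ∂P = 0)
    (h1 : ∑ i, ∫ ω, X i ω ^ 2 ∂P = 1) (z : ℝ) :
    |P.real {ω | z ≤ ∑ i, X i ω} - normalTail z| ≤ 9.4 * ∑ i, ∫ ω, |X i ω| ^ 3 ∂P := by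
  have h := abs_measure_sum_le_sub_normalTail_le (X := fun i ω => -X i ω) (P := P)
    (hind.comp (fun _ x => -x) fun _ => measurable_neg) (fun i => (hX i).neg)
    (fun i => by rw [integral_neg, h0, neg_zero]) (by simpa using h1) (-z)
  simpa [Finset.sum_neg_distrib] using h

theorem abs_measure_lt_sum_sub_normalTail_le (hind : iIndepFun X P)
    (hX : ∀ i, BddMeasurable (X i)) (h0 : ∀ i, ∫ ω, X i ω ∂P = 0)
    (h1 : ∑ i, ∫ ω, X i ω ^ 2 ∂P = 1) (z : ℝ) :
    |P.real {ω | z < ∑ i, X i ω} - normalTail z| ≤ 9.4 * ∑ i, ∫ ω, |X i ω| ^ 3 ∂P := by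
  have h := abs_measure_sum_le_sub_normalTail_le hind hX h0 h1 z
  have hm : MeasurableSet {ω | ∑ i, X i ω ≤ z} :=
    (BddMeasurable.sum _ fun i _ => hX i).1 measurableSet_Iic
  have e : {ω | z < ∑ i, X i ω} = {ω | ∑ i, X i ω ≤ z}ᶜ := by
    ext ω; simp
  rw [e, probReal_compl_eq_one_sub hm, ← abs_neg]
  have e' : -(1 - P.real {ω | ∑ i, X i ω ≤ z} - normalTail z) =
      P.real {ω | ∑ i, X i ω ≤ z} - normalTail (-z) := by
    linear_combination normalTail_add_neg z
  rwa [e']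

end BerryEsseen

/-! ### Conditioning on discrete variables; normal probabilities of the half-line -/

lemma cond_real_mul {Ω : Type*} [MeasurableSpace Ω] {P : Measure Ω} [IsFiniteMeasure P]
    {A : Set Ω} (hA : MeasurableSet A) (D : Set Ω) :
    (P[|A]).real D * P.real A = P.real (A ∩ D) := by
  rw [measureReal_def, measureReal_def, measureReal_def, ← ENNReal.toReal_mul,
    cond_mul_eq_inter hA]

lemma sum_measureReal_preimage_singleton_inter {Ω α : Type*} [MeasurableSpace Ω] {P : Measure Ω}
    [IsFiniteMeasure P] [MeasurableSpace α] [MeasurableSingletonClass α] {f : Ω → α}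
    (hf : Measurable f) (E : Finset α) (D : Set Ω) :
    ∑ x ∈ E, P.real (f ⁻¹' {x} ∩ D) = P.real (f ⁻¹' (E : Set α) ∩ D) := by
  have h := sum_measureReal_preimage_singleton (μ := P.restrict D) E (f := f)
    (fun x _ => hf (measurableSet_singleton x))
  rw [measureReal_restrict_apply (hf E.measurableSet)] at h
  rw [← h]
  exact Finset.sum_congr rfl fun x _ =>
    (measureReal_restrict_apply (hf (measurableSet_singleton x))).symm

/-- This total-probability argument carries conditional probabilities given all types over to the
coarser C^Q and C^Q_j, since they do not depend on the forgotten types. -/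
lemma measureReal_preimage_inter_eq_mul {Ω α : Type*} [MeasurableSpace Ω] {P : Measure Ω}
    [IsFiniteMeasure P] [MeasurableSpace α] [MeasurableSingletonClass α] {f : Ω → α}
    (hf : Measurable f) (E : Finset α) {D : Set Ω} {κ : ℝ}
    (h : ∀ x ∈ E, P (f ⁻¹' {x}) ≠ 0 → (P[|f ⁻¹' {x}]).real D = κ) :
    P.real (f ⁻¹' (E : Set α) ∩ D) = κ * P.real (f ⁻¹' (E : Set α)) := by
  rw [← sum_measureReal_preimage_singleton_inter hf E D]
  have h2 := sum_measureReal_preimage_singleton_inter (P := P) hf E Set.univ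
  simp only [Set.inter_univ] at h2
  rw [← h2, Finset.mul_sum]
  refine Finset.sum_congr rfl fun x hx => ?_
  rw [← cond_real_mul (hf (measurableSet_singleton x))]
  by_cases h0 : P (f ⁻¹' {x}) = 0
  · simp [measureReal_def, h0]
  · rw [h x hx h0]

lemma gaussianReal_real_Ioi_zero (m : ℝ) {v : ℝ} (hv : 0 < v) :
    (gaussianReal m v.toNNReal).real (Set.Ioi 0) = normalTail (-m / √v) := by
  have hs : 0 < √v := Real.sqrt_pos.2 hv
  have h1 : (gaussianReal 0 1).map (fun x => √v * x + m) = gaussianReal m v.toNNReal := by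
    have := Measure.map_map (μ := gaussianReal 0 1) (measurable_add_const m)
      (measurable_const_mul √v)
    rw [gaussianReal_map_const_mul, gaussianReal_map_add_const] at this
    rw [Function.comp_def] at this
    rw [← this]
    congr 1
    · ring
    · ext
      simp [Real.sq_sqrt hv.le, hv.le]
  rw [← h1, map_measureReal_apply (by fun_prop) measurableSet_Ioi, ← gaussianReal_real_Ioi]
  congr 1
  ext x
  simp only [Set.mem_preimage, Set.mem_Ioi]
  rw [div_lt_iff₀ hs]
  constructor <;> intro h <;> linarith

/-! ### The blockmodel given the types of Q and of the objects -/

namespace BipartiteSBM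

variable {Ω : Type*} [MeasurableSpace Ω] {P : Measure Ω} {q d K L : ℕ}

/-- The types of all agents and of all objects. -/
def types (M : BipartiteSBM P q d K L) (ω : Ω) : (Fin q → Fin K) × (Fin d → Fin L) :=
  (fun i => M.s i ω, fun j => M.t j ω)

lemma measurable_types (M : BipartiteSBM P q d K L) : Measurable M.types :=
  (measurable_pi_lambda _ M.measurable_s).prodMk (measurable_pi_lambda _ M.measurable_t)

lemma types_preimage_singleton (M : BipartiteSBM P q d K L)
    (x : (Fin q → Fin K) × (Fin d → Fin L)) :
    M.types ⁻¹' {x} = {ω | (∀ i, M.s i ω = x.1 i) ∧ ∀ j, M.t j ω = x.2 j} := by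
  ext ω
  simp [types, Prod.ext_iff, funext_iff]

lemma measurableSet_connected (M : BipartiteSBM P q d K L) (Q : Finset (Fin q)) (j : Fin d) :
    MeasurableSet (M.connected Q j) :=
  Finset.measurableSet_biUnion _ fun i _ => M.measurableSet_edge i j

/-- The probability, given the types `c`, that no agent of `Q` is joined to the object `j`. -/
def isolationProb (M : BipartiteSBM P q d K L) {Q : Finset (Fin q)} (c : QConfig Q d K L)
    (j : Fin d) : ℝ :=
  ∏ i : Q, (1 - M.p (c.1 i) (c.2 j))

/-- Isolation is easier to handle than connection: it is an intersection of absent edges, and for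
different objects these are disjoint families of independent events. -/
lemma cond_types_real_iInter_compl (M : BipartiteSBM P q d K L) [IsProbabilityMeasure P]
    (Q : Finset (Fin q)) (T : Finset (Fin d)) (x : (Fin q → Fin K) × (Fin d → Fin L))
    (hx : P (M.types ⁻¹' {x}) ≠ 0) :
    (P[|M.types ⁻¹' {x}]).real (⋂ j ∈ T, (M.connected Q j)ᶜ) =
      ∏ j ∈ T, ∏ i ∈ Q, (1 - M.p (x.1 i) (x.2 j)) := by
  have hpr : IsProbabilityMeasure P[|M.types ⁻¹' {x}] := cond_isProbabilityMeasure hx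
  rw [types_preimage_singleton] at hx hpr ⊢
  have hind := (iIndepSet_iff_iIndep _ _).1 (M.cond_indep x.1 x.2 hx)
  have e : (⋂ j ∈ T, (M.connected Q j)ᶜ) = ⋂ e ∈ Q ×ˢ T, (M.edge e.1 e.2)ᶜ := by
    ext ω
    simp only [connected, Set.compl_iUnion, Set.mem_iInter, Finset.mem_product, Prod.forall]
    constructor
    · intro h i j hij
      exact h j hij.2 i hij.1
    · intro h j hj i hi
      exact h i j ⟨hi, hj⟩
  rw [e, measureReal_def, hind.meas_biInter (s := fun e => (M.edge e.1 e.2)ᶜ) fun e _ =>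
    (MeasurableSpace.measurableSet_generateFrom (Set.mem_singleton _)).compl, ENNReal.toReal_prod,
    Finset.prod_product_right]
  refine Finset.prod_congr rfl fun j _ => Finset.prod_congr rfl fun i _ => ?_
  rw [← measureReal_def, probReal_compl_eq_one_sub (M.measurableSet_edge i j),
    M.cond_edge x.1 x.2 hx]

lemma configEvent_eq_preimage (M : BipartiteSBM P q d K L) {Q : Finset (Fin q)}
    (c : QConfig Q d K L) : M.configEvent c = M.types ⁻¹'
      ((Finset.univ.filter fun x : (Fin q → Fin K) × (Fin d → Fin L) =>
        (∀ i : Q, x.1 i = c.1 i) ∧ ∀ j, x.2 j = c.2 j : Finset _) : Set _) := by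
  ext ω
  simp [configEvent, types]

lemma configEventAt_eq_preimage (M : BipartiteSBM P q d K L) {Q : Finset (Fin q)}
    (c : QConfig Q d K L) (j : Fin d) : M.configEventAt c j = M.types ⁻¹'
      ((Finset.univ.filter fun x : (Fin q → Fin K) × (Fin d → Fin L) =>
        (∀ i : Q, x.1 i = c.1 i) ∧ x.2 j = c.2 j : Finset _) : Set _) := by
  ext ω
  simp [configEventAt, types]

lemma measurableSet_configEvent (M : BipartiteSBM P q d K L) {Q : Finset (Fin q)}
    (c : QConfig Q d K L) : MeasurableSet (M.configEvent c) := by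
  rw [configEvent_eq_preimage]
  exact M.measurable_types (Finset.measurableSet _)

lemma measurableSet_configEventAt (M : BipartiteSBM P q d K L) {Q : Finset (Fin q)}
    (c : QConfig Q d K L) (j : Fin d) : MeasurableSet (M.configEventAt c j) := by
  rw [configEventAt_eq_preimage]
  exact M.measurable_types (Finset.measurableSet _)

lemma bddMeasurable_I (M : BipartiteSBM P q d K L) (Q : Finset (Fin q)) (j : Fin d) :
    BddMeasurable (M.I Q j) :=
  BddMeasurable.indicator_one (M.measurableSet_connected Q j)

lemma bddMeasurable_Z (M : BipartiteSBM P q d K L) {Q : Finset (Fin q)} (lam : ℝ)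
    (μ prem : Fin d → ℝ) (c : QConfig Q d K L) (j : Fin d) :
    BddMeasurable (M.Z lam μ prem c j) :=
  (BddMeasurable.const _).mul ((M.bddMeasurable_I Q j).sub (BddMeasurable.const _))

lemma sum_Z (M : BipartiteSBM P q d K L) {Q : Finset (Fin q)} (lam : ℝ)
    (μ prem : Fin d → ℝ) (c : QConfig Q d K L) (ω : Ω) :
    ∑ j, M.Z lam μ prem c j ω =
      (∑ j, (xi lam μ prem j - 1) * M.I Q j ω - M.mean lam μ prem c) /
        √(M.sigmaSq lam μ prem c) := by
  rw [mean, ← Finset.sum_sub_distrib, Finset.sum_div]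
  refine Finset.sum_congr rfl fun j _ => ?_
  rw [Z]; ring

lemma I_nonneg (M : BipartiteSBM P q d K L) (Q : Finset (Fin q)) (j : Fin d) (ω : Ω) :
    0 ≤ M.I Q j ω :=
  Set.indicator_nonneg (fun _ _ => zero_le_one) ω

lemma sum_xi_sub_one_mul_I (M : BipartiteSBM P q d K L) (Q : Finset (Fin q)) (lam : ℝ)
    (μ prem : Fin d → ℝ) (ω : Ω) :
    ∑ j, (xi lam μ prem j - 1) * M.I Q j ω =
      (∑ j, M.I Q j ω * (prem j / μ j)) / lam - ∑ j, M.I Q j ω := by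
  rw [Finset.sum_div, ← Finset.sum_sub_distrib]
  refine Finset.sum_congr rfl fun j _ => ?_
  rw [xi, one_div_div]
  ring

lemma PQ_lt_one_of_pos (M : BipartiteSBM P q d K L) {Q : Finset (Fin q)} {lam : ℝ} (hlam : 0 < lam)
    {μ prem : Fin d → ℝ} {ω : Ω}
    (h : 0 < ∑ j, (xi lam μ prem j - 1) * M.I Q j ω) : M.PQ Q lam μ prem ω < 1 := by
  rw [sum_xi_sub_one_mul_I, sub_pos, lt_div_iff₀ hlam] at h
  have hn : 0 ≤ ∑ j, M.I Q j ω := Finset.sum_nonneg fun j _ => M.I_nonneg Q j ω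
  have hD : 0 < ∑ j, M.I Q j ω * (prem j / μ j) := (mul_nonneg hn hlam.le).trans_lt h
  rw [PQ, ← mul_div_assoc, div_lt_one hD, mul_comm]
  exact h

lemma nonneg_of_PQ_lt_one (M : BipartiteSBM P q d K L) {Q : Finset (Fin q)} {lam : ℝ}
    (hlam : 0 < lam) {μ prem : Fin d → ℝ} (hμ : ∀ j, 0 < μ j) (hprem : ∀ j, 0 < prem j) {ω : Ω}
    (h : M.PQ Q lam μ prem ω < 1) : 0 ≤ ∑ j, (xi lam μ prem j - 1) * M.I Q j ω := by
  have hr : ∀ j, 0 < prem j / μ j := fun j => div_pos (hprem j) (hμ j)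
  have hnn : ∀ j ∈ Finset.univ, 0 ≤ M.I Q j ω * (prem j / μ j) := fun j _ =>
    mul_nonneg (M.I_nonneg Q j ω) (hr j).le
  -- A zero denominator forces every I_j = 0, the case 0/0 := 0; there S = 0, so only S ≥ 0 can be
  -- concluded.
  rcases (Finset.sum_nonneg hnn).eq_or_lt with h0 | hD
  · have hI : ∀ j, M.I Q j ω = 0 := fun j =>
      (mul_eq_zero.1 ((Finset.sum_eq_zero_iff_of_nonneg hnn).1 h0.symm j
        (Finset.mem_univ j))).resolve_right (hr j).ne'
    simp [hI]
  · rw [PQ, ← mul_div_assoc, div_lt_one hD, mul_comm] at h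
    rw [sum_xi_sub_one_mul_I, sub_nonneg, le_div_iff₀ hlam]
    exact h.le

variable [IsProbabilityMeasure P]

lemma cond_configEvent_real_iInter_compl (M : BipartiteSBM P q d K L) {Q : Finset (Fin q)}
    (c : QConfig Q d K L) (hc : P (M.configEvent c) ≠ 0) (T : Finset (Fin d)) :
    (P[|M.configEvent c]).real (⋂ j ∈ T, (M.connected Q j)ᶜ) = ∏ j ∈ T, M.isolationProb c j := by
  have hc' : P.real (M.configEvent c) ≠ 0 := by
    rw [measureReal_def]; exact ENNReal.toReal_ne_zero.2 ⟨hc, measure_ne_top _ _⟩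
  refine mul_right_cancel₀ hc' ?_
  rw [cond_real_mul (M.measurableSet_configEvent c), configEvent_eq_preimage]
  refine measureReal_preimage_inter_eq_mul M.measurable_types _ fun x hx h0 => ?_
  rw [M.cond_types_real_iInter_compl Q T x h0]
  simp only [Finset.mem_filter, Finset.mem_univ, true_and] at hx
  refine Finset.prod_congr rfl fun j _ => ?_
  rw [isolationProb, ← Finset.prod_coe_sort]
  exact Finset.prod_congr rfl fun i _ => by rw [hx.1 i, hx.2 j]

/-- Conditioning on C^Q_j alone gives the same product, as the types of other objects do not matter.
Hence p(c_j) is also the mean of I_j given C^Q = c. -/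
lemma pc_eq_one_sub_isolationProb (M : BipartiteSBM P q d K L) {Q : Finset (Fin q)}
    (c : QConfig Q d K L) (hc : P (M.configEvent c) ≠ 0) (j : Fin d) :
    M.pc c j = 1 - M.isolationProb c j := by
  have hsub : M.configEvent c ⊆ M.configEventAt c j := fun ω hω => ⟨hω.1, hω.2 j⟩
  have hj : P (M.configEventAt c j) ≠ 0 := fun h => hc (measure_mono_null hsub h)
  have hpr : IsProbabilityMeasure P[|M.configEventAt c j] := cond_isProbabilityMeasure hj
  have hj' : P.real (M.configEventAt c j) ≠ 0 := by
    rw [measureReal_def]; exact ENNReal.toReal_ne_zero.2 ⟨hj, measure_ne_top _ _⟩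
  have key : (P[|M.configEventAt c j]).real (M.connected Q j)ᶜ = M.isolationProb c j := by
    refine mul_right_cancel₀ hj' ?_
    rw [cond_real_mul (M.measurableSet_configEventAt c j), configEventAt_eq_preimage]
    refine measureReal_preimage_inter_eq_mul M.measurable_types _ fun x hx h0 => ?_
    have h := M.cond_types_real_iInter_compl Q {j} x h0
    simp only [Finset.mem_filter, Finset.mem_univ, true_and] at hx
    simp only [Finset.mem_singleton, Set.iInter_iInter_eq_left, Finset.prod_singleton] at h
    rw [h, isolationProb, ← Finset.prod_coe_sort]
    exact Finset.prod_congr rfl fun i _ => by rw [hx.1 i, hx.2]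
  rw [probReal_compl_eq_one_sub (M.measurableSet_connected Q j)] at key
  rw [pc, ← key]; ring

lemma cond_configEvent_real_connected (M : BipartiteSBM P q d K L) {Q : Finset (Fin q)}
    (c : QConfig Q d K L) (hc : P (M.configEvent c) ≠ 0) (j : Fin d) :
    (P[|M.configEvent c]).real (M.connected Q j) = M.pc c j := by
  have hpr : IsProbabilityMeasure P[|M.configEvent c] := cond_isProbabilityMeasure hc
  have h := M.cond_configEvent_real_iInter_compl c hc {j}
  simp only [Finset.mem_singleton, Set.iInter_iInter_eq_left, Finset.prod_singleton] at h
  rw [probReal_compl_eq_one_sub (M.measurableSet_connected Q j)] at h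
  rw [M.pc_eq_one_sub_isolationProb c hc, ← h]; ring

lemma iIndepSet_compl_connected (M : BipartiteSBM P q d K L) {Q : Finset (Fin q)}
    (c : QConfig Q d K L) (hc : P (M.configEvent c) ≠ 0) :
    iIndepSet (fun j => (M.connected Q j)ᶜ) P[|M.configEvent c] := by
  have hpr : IsProbabilityMeasure P[|M.configEvent c] := cond_isProbabilityMeasure hc
  rw [iIndepSet_iff_meas_biInter fun j => (M.measurableSet_connected Q j).compl]
  intro T
  rw [← ENNReal.toReal_eq_toReal_iff' (measure_ne_top _ _)
    (ENNReal.prod_ne_top fun j _ => measure_ne_top _ _), ENNReal.toReal_prod, ← measureReal_def,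
    M.cond_configEvent_real_iInter_compl c hc]
  refine Finset.prod_congr rfl fun j _ => ?_
  have h := M.cond_configEvent_real_iInter_compl c hc {j}
  simp only [Finset.mem_singleton, Set.iInter_iInter_eq_left, Finset.prod_singleton] at h
  rw [← measureReal_def, h]

lemma iIndepFun_Z (M : BipartiteSBM P q d K L) {Q : Finset (Fin q)} (lam : ℝ)
    (μ prem : Fin d → ℝ) (c : QConfig Q d K L) (hc : P (M.configEvent c) ≠ 0) :
    iIndepFun (M.Z lam μ prem c) P[|M.configEvent c] := by
  have h := (M.iIndepSet_compl_connected c hc).iIndepFun_indicator (β := ℝ)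
    (m := Real.measurableSpace)
  -- Here x is the indicator of isolation, so I_j = 1 - x.
  have h2 := h.comp (fun j x => 1 / √(M.sigmaSq lam μ prem c) * (xi lam μ prem j - 1) *
    ((1 - x) - M.pc c j)) fun j => by fun_prop
  convert h2 using 1
  funext j ω
  by_cases hω : ω ∈ M.connected Q j <;> simp [Z, I, hω]

lemma integral_I (M : BipartiteSBM P q d K L) {Q : Finset (Fin q)}
    (c : QConfig Q d K L) (hc : P (M.configEvent c) ≠ 0) (j : Fin d) :
    ∫ ω, M.I Q j ω ∂P[|M.configEvent c] = M.pc c j := by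
  rw [← M.cond_configEvent_real_connected c hc]
  exact integral_indicator_one (M.measurableSet_connected Q j)

lemma integral_Z (M : BipartiteSBM P q d K L) {Q : Finset (Fin q)} (lam : ℝ)
    (μ prem : Fin d → ℝ) (c : QConfig Q d K L) (hc : P (M.configEvent c) ≠ 0) (j : Fin d) :
    ∫ ω, M.Z lam μ prem c j ω ∂P[|M.configEvent c] = 0 := by
  have hpr : IsProbabilityMeasure P[|M.configEvent c] := cond_isProbabilityMeasure hc
  simp only [Z]
  rw [integral_const_mul, integral_sub (M.bddMeasurable_I Q j).integrable (integrable_const _),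
    M.integral_I c hc]
  simp

lemma sum_integral_Z_sq (M : BipartiteSBM P q d K L) {Q : Finset (Fin q)} (lam : ℝ)
    (μ prem : Fin d → ℝ) (c : QConfig Q d K L) (hc : P (M.configEvent c) ≠ 0)
    (hσ : 0 < M.sigmaSq lam μ prem c) :
    ∑ j, ∫ ω, M.Z lam μ prem c j ω ^ 2 ∂P[|M.configEvent c] = 1 := by
  have hpr : IsProbabilityMeasure P[|M.configEvent c] := cond_isProbabilityMeasure hc
  have h : ∀ j, ∫ ω, M.Z lam μ prem c j ω ^ 2 ∂P[|M.configEvent c] =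
      (xi lam μ prem j - 1) ^ 2 * M.pc c j * (1 - M.pc c j) / M.sigmaSq lam μ prem c := by
    intro j
    have e : ∀ ω, M.Z lam μ prem c j ω ^ 2 = (xi lam μ prem j - 1) ^ 2 / M.sigmaSq lam μ prem c *
        ((1 - 2 * M.pc c j) * M.I Q j ω + M.pc c j ^ 2) := by
      intro ω
      have hI : M.I Q j ω ^ 2 = M.I Q j ω := by
        by_cases hω : ω ∈ M.connected Q j <;> simp [I, hω]
      rw [Z, mul_pow, mul_pow, div_pow, Real.sq_sqrt hσ.le]
      linear_combination (xi lam μ prem j - 1) ^ 2 / M.sigmaSq lam μ prem c * hI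
    simp only [e]
    rw [integral_const_mul, integral_add ((M.bddMeasurable_I Q j).integrable.const_mul _)
      (integrable_const _), integral_const_mul, M.integral_I c hc]
    simp only [integral_const, probReal_univ, smul_eq_mul, one_mul]
    ring
  simp only [h]
  rw [← Finset.sum_div]
  exact div_self hσ.ne'

/-- The normal approximation of `{P^Q < 1}` given the type configuration. -/
lemma abs_cond_real_PQ_lt_one_sub_le (M : BipartiteSBM P q d K L) {Q : Finset (Fin q)} {lam : ℝ}
    (hlam : 0 < lam) {μ prem : Fin d → ℝ} (hμ : ∀ j, 0 < μ j) (hprem : ∀ j, 0 < prem j)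
    (c : QConfig Q d K L) (hc : P (M.configEvent c) ≠ 0) (hσ : 0 < M.sigmaSq lam μ prem c) :
    |(P[|M.configEvent c]).real {ω | M.PQ Q lam μ prem ω < 1} -
      (gaussianReal (M.mean lam μ prem c) (M.sigmaSq lam μ prem c).toNNReal).real (Set.Ioi 0)| ≤
      9.4 * ∑ j, ∫ ω, |M.Z lam μ prem c j ω| ^ 3 ∂P[|M.configEvent c] := by
  have hpr : IsProbabilityMeasure P[|M.configEvent c] := cond_isProbabilityMeasure hc
  have hs : 0 < √(M.sigmaSq lam μ prem c) := Real.sqrt_pos.2 hσ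
  have hind := M.iIndepFun_Z lam μ prem c hc
  have hlt := abs_measure_lt_sum_sub_normalTail_le hind (M.bddMeasurable_Z lam μ prem c)
    (M.integral_Z lam μ prem c hc) (M.sum_integral_Z_sq lam μ prem c hc hσ)
    (-M.mean lam μ prem c / √(M.sigmaSq lam μ prem c))
  have hle := abs_measure_le_sum_sub_normalTail_le hind (M.bddMeasurable_Z lam μ prem c)
    (M.integral_Z lam μ prem c hc) (M.sum_integral_Z_sq lam μ prem c hc hσ)
    (-M.mean lam μ prem c / √(M.sigmaSq lam μ prem c))
  -- The events S > 0 and S ≥ 0 enclose P^Q < 1 and are compared with the same normal tail, so an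
  -- atom of S at 0 costs nothing.
  have h1 : (P[|M.configEvent c]).real {ω | -M.mean lam μ prem c / √(M.sigmaSq lam μ prem c) <
      ∑ j, M.Z lam μ prem c j ω} ≤ (P[|M.configEvent c]).real {ω | M.PQ Q lam μ prem ω < 1} := by
    refine measureReal_mono fun ω hω => M.PQ_lt_one_of_pos hlam ?_
    rw [Set.mem_ofPred_eq, sum_Z, div_lt_div_iff_of_pos_right hs] at hω
    linarith
  have h2 : (P[|M.configEvent c]).real {ω | M.PQ Q lam μ prem ω < 1} ≤
      (P[|M.configEvent c]).real {ω | -M.mean lam μ prem c / √(M.sigmaSq lam μ prem c) ≤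
      ∑ j, M.Z lam μ prem c j ω} := by
    refine measureReal_mono fun ω hω => ?_
    have := M.nonneg_of_PQ_lt_one hlam hμ hprem hω
    rw [Set.mem_ofPred_eq, sum_Z, div_le_div_iff_of_pos_right hs]
    linarith
  rw [gaussianReal_real_Ioi_zero _ hσ]
  rw [abs_le] at hlt hle ⊢
  constructor <;> linarith [hlt.1, hle.2]

lemma sum_configEvent_mul_cond (M : BipartiteSBM P q d K L) (Q : Finset (Fin q)) (D : Set Ω) :
    P.real D = ∑ c : QConfig Q d K L, P.real (M.configEvent c) *
      (P[|M.configEvent c]).real D := by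
  set f : Ω → QConfig Q d K L := fun ω => (fun i => M.s i ω, fun j => M.t j ω) with hf
  have hfm : Measurable f :=
    (measurable_pi_lambda (fun ω (i : Q) => M.s i ω) fun i => M.measurable_s i).prodMk
      (measurable_pi_lambda _ M.measurable_t)
  have e : ∀ c, f ⁻¹' {c} = M.configEvent c := by
    intro c
    ext ω
    simp [hf, configEvent, Prod.ext_iff, funext_iff]
  have h := sum_measureReal_preimage_singleton_inter (P := P) hfm Finset.univ D
  simp only [e, Finset.coe_univ, Set.preimage_univ, Set.univ_inter] at h
  rw [← h]
  exact Finset.sum_congr rfl fun c _ => by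
    rw [mul_comm, cond_real_mul (M.measurableSet_configEvent c)]

lemma mixtureLaw_real (M : BipartiteSBM P q d K L) (Q : Finset (Fin q)) (lam : ℝ)
    (μ prem : Fin d → ℝ) (S : Set ℝ) :
    (M.mixtureLaw Q lam μ prem).real S = ∑ c : QConfig Q d K L, P.real (M.configEvent c) *
      (gaussianReal (M.mean lam μ prem c) (M.sigmaSq lam μ prem c).toNNReal).real S := by
  rw [mixtureLaw, measureReal_def, Measure.finsetSum_apply, ENNReal.toReal_sum]
  · refine Finset.sum_congr rfl fun c _ => ?_
    rw [Measure.smul_apply, smul_eq_mul, ENNReal.toReal_mul]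
    rfl
  · intro c _
    rw [Measure.smul_apply, smul_eq_mul]
    exact ENNReal.mul_ne_top (measure_ne_top _ _) (measure_ne_top _ _)

end BipartiteSBM

/-! ### Averaging over the type configurations -/

theorem theorem2 {Ω Ω' : Type*} [MeasurableSpace Ω] [MeasurableSpace Ω']
    {P : Measure Ω} [IsProbabilityMeasure P] {P' : Measure Ω'} [IsProbabilityMeasure P']
    {q d K L : ℕ} (M : BipartiteSBM P q d K L)
    (Q : Finset (Fin q)) (hQ : Q.Nonempty)
    (lam : ℝ) (hlam : 0 < lam) (μ prem : Fin d → ℝ) (hμ : ∀ j, 0 < μ j) (hprem : ∀ j, 0 < prem j)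
    (hσ : ∀ c : QConfig Q d K L, 0 < P (M.configEvent c) → 0 < M.sigmaSq lam μ prem c)
    (N : Ω' → ℝ) (hN : HasLaw N (M.mixtureLaw Q lam μ prem) P') :
    |P.real {ω | M.PQ Q lam μ prem ω < 1} - P'.real {ω | 0 < N ω}|
      ≤ 9.4 * ∑ c : QConfig Q d K L, P.real (M.configEvent c) *
          ∑ j, ∫ ω, |M.Z lam μ prem c j ω| ^ 3 ∂P[|M.configEvent c] := by
  have hPN : P'.real {ω | 0 < N ω} = (M.mixtureLaw Q lam μ prem).real (Set.Ioi 0) := by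
    rw [← hN.map_eq, measureReal_def, measureReal_def,
      Measure.map_apply_of_aemeasurable hN.aemeasurable measurableSet_Ioi]
    rfl
  rw [hPN, M.mixtureLaw_real, M.sum_configEvent_mul_cond Q, ← Finset.sum_sub_distrib,
    Finset.mul_sum]
  refine (Finset.abs_sum_le_sum_abs _ _).trans (Finset.sum_le_sum fun c _ => ?_)
  rw [← mul_sub, abs_mul, abs_of_nonneg measureReal_nonneg, mul_left_comm]
  -- The sums run over all c; null configurations have weight 0 and contribute nothing to either
  -- side.
  rcases eq_or_ne (P (M.configEvent c)) 0 with hc | hc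
  · simp [measureReal_def, hc]
  · exact mul_le_mul_of_nonneg_left (M.abs_cond_real_PQ_lt_one_sub_le hlam hμ hprem c hc
      (hσ c (pos_iff_ne_zero.2 hc))) measureReal_nonneg
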